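/- **Definitions.** A *de Vries algebra* is a pair $(A,\prec)$ of a complete Boolean algebra $A$ and a binary relation $\prec$ on $A$ such that: $1\prec 1$; $a\prec b$ implies $a\le b$; $a\le b\prec c\le d$ implies $a\prec d$; $a\prec b$ and $a\prec c$ imply $a\prec b\wedge c$; $a\prec b$ implies $\neg b\prec\neg a$; $a\prec b$ implies $a\prec c\prec b$ for some $c$; and $b\neq 0$ implies $a\prec b$ for some $a\neq 0$. A *de Vries morphism* is a map $\rho$ between de Vries algebras with $\rho(0)=0$, $\rho(a\wedge b)=\rho(a)\wedge\rho(b)$, $\neg\rho(\neg a)\prec\rho(b)$ whenever $a\prec b$, and $\rho(b)=\bigvee\{\rho(a)\mid a\prec b\}$. De Vries algebras and de Vries morphisms form a category $\mathsf{DeV}$ with composition $(\rho_2\star\rho_1)(b)=\bigvee\{\rho_2\rho_1(a)\mid a\prec b\}$. Let $\mathsf{CABA}$ be the category of complete and atomic Boolean algebras and complete Boolean homomorphisms; each $B\in\mathsf{CABA}$ is regarded as the de Vries algebra $(B,\le)$. A *de Vries extension* is an injective de Vries morphism $\alpha:A\to B$ from a de Vries algebra $A$ to some $B=(B,\le)$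 with $B\in\mathsf{CABA}$, such that each element of $B$ is a join of meets of elements of $\alpha[A]$. A morphism from $\alpha:A\to B$ to $\alpha':A'\to B'$ is a pair $(\rho,\sigma)$ of a de Vries morphism $\rho:A\to A'$ and a complete Boolean homomorphism $\sigma:B\to B'$ with $\sigma\circ\alpha=\alpha'\star\rho$; composition is $(\rho_2,\sigma_2)(\rho_1,\sigma_1)=(\rho_2\star\rho_1,\sigma_2\circ\sigma_1)$. The extension $\alpha$ is *maximal* if for every de Vries extension $\gamma:C\to B$ with $\gamma[C]=\alpha[A]$ there is a de Vries morphism $\delta:C\to A$ with $\alpha\star\delta=\gamma$. Let $\mathsf{MDeVe}$ be the full subcategory of maximal de Vries extensions, in the category of de Vries extensions. Let $\mathsf{CReg}$ be the category of completely regular (Hausdorff) spaces and continuous maps, and $\mathsf{KHaus}$ that of compact Hausdorff spaces. For $Y\in\mathsf{KHaus}$ let $Y^*=(\mathcal{RO}(Y),\prec)$ be the complete Boolean algebra of regular open subsets of $Y$, with $U\prec V$ iff $\mathrm{cl}(U)\subseteq V$; for a continuous $g:Y\to Z$ let $g^*(U)=\mathrm{int}(\mathrm{cl}(g^{-1}(U)))$.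 This gives a functor $(-)^*:\mathsf{KHaus}^{op}\to\mathsf{DeV}$. Let $\wp:\mathsf{Set}^{op}\to\mathsf{CABA}$ be the functor $X\mapsto\wp(X)$, $f\mapsto f^{-1}$. **Theorem.** $\mathsf{CReg}$ is dually equivalent to $\mathsf{MDeVe}$, by an equivalence that extends de Vries duality and Tarski duality. Precisely, there is an equivalence of categories $F:\mathsf{CReg}^{op}\to\mathsf{MDeVe}$ with the following properties. 1. Up to natural isomorphisms of the two components that commute with the extensions, $F$ sends $X$ to $s^{-1}:\mathcal{RO}(\beta X)\to\wp(X)$, where $s:X\to\beta X$ is the Stone–Čech compactification, and sends $f$ to $((\beta f)^*,f^{-1})$. 2. The functor $(-)^*$ is an equivalence, and there is a full and faithful functor $J:\mathsf{DeV}\to\mathsf{MDeVe}$ such that the domain of the extension $J(A)$ is naturally isomorphic to $A$ and such that the restriction of $F$ to compact Hausdorff spaces is naturally isomorphic to $J\circ(-)^*$. 3. The functor $\wp$ is an equivalence, the functor $I:\mathsf{CABA}\to\mathsf{MDeVe}$ that sends $B$ to $\mathrm{id}:(B,\le)\to(B,\le)$ and $\sigma$ to $(\sigma,\sigma)$ is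 full and faithful, and the restriction of $F$ to discrete spaces is naturally isomorphic to $I\circ\wp$. -/

import Mathlib

open CategoryTheory Opposite TopologicalSpace

universe u

/-! ## De Vries algebras -/

/-- A de Vries proximity on a Boolean algebra. -/
structure IsDeVriesProximity {A : Type u} [BooleanAlgebra A] (r : A → A → Prop) : Prop where
  dv1 : r ⊤ ⊤
  dv2 : ∀ a b, r a b → a ≤ b
  dv3 : ∀ a b c d, a ≤ b → r b c → c ≤ d → r a d
  dv4 : ∀ a b c, r a b → r a c → r a (b ⊓ c)
  dv5 : ∀ a b, r a b → r bᶜ aᶜ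
  dv6 : ∀ a b, r a b → ∃ c, r a c ∧ r c b
  dv7 : ∀ b, b ≠ ⊥ → ∃ a, a ≠ ⊥ ∧ r a b

/-- A de Vries algebra: a complete Boolean algebra with a de Vries proximity `prec`. -/
structure DeV : Type (u + 1) where
  carrier : Type u
  [str : CompleteBooleanAlgebra carrier]
  prec : carrier → carrier → Prop
  isProx : IsDeVriesProximity prec

namespace DeV

instance : CoeSort DeV.{u} (Type u) := ⟨DeV.carrier⟩

instance (A : DeV.{u}) : CompleteBooleanAlgebra A := A.str

/-- A de Vries morphism. -/
@[ext]
structure Hom (A B : DeV.{u}) : Type u where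
  toFun : A → B
  map_bot : toFun ⊥ = ⊥
  map_inf : ∀ a b, toFun (a ⊓ b) = toFun a ⊓ toFun b
  map_prec : ∀ a b, A.prec a b → B.prec (toFun aᶜ)ᶜ (toFun b)
  map_approx : ∀ b, toFun b = sSup {y | ∃ a, A.prec a b ∧ y = toFun a}

theorem bot_prec_bot (A : DeV.{u}) : A.prec ⊥ ⊥ := by
  have h := A.isProx.dv5 _ _ A.isProx.dv1
  rwa [compl_top] at h

theorem sSup_prec (A : DeV.{u}) (b : A) : b = sSup {y | ∃ a, A.prec a b ∧ y = a} := by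
  set s : A := sSup {y | ∃ a, A.prec a b ∧ y = a} with hs
  have hle : s ≤ b := sSup_le (by rintro _ ⟨a, ha, rfl⟩; exact A.isProx.dv2 _ _ ha)
  refine le_antisymm ?_ hle
  by_contra hn
  have hne : b ⊓ sᶜ ≠ ⊥ := fun h => hn (by rwa [← sdiff_eq, sdiff_eq_bot_iff] at h)
  obtain ⟨a, ha0, ha⟩ := A.isProx.dv7 _ hne
  have h1 : a ≤ s := le_sSup ⟨a, A.isProx.dv3 _ _ _ _ le_rfl ha inf_le_left, rfl⟩
  have h2 : a ≤ sᶜ := (A.isProx.dv2 _ _ ha).trans inf_le_right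
  exact ha0 (le_bot_iff.1 ((le_inf h1 h2).trans (inf_compl_self s).le))

namespace Hom

variable {A B C D : DeV.{u}}

theorem mono (f : Hom A B) {a b : A} (h : a ≤ b) : f.toFun a ≤ f.toFun b := by
  have := f.map_inf a b
  rw [inf_eq_left.2 h] at this
  rw [this]; exact inf_le_right

theorem toFun_le_compl (f : Hom A B) (a : A) : f.toFun a ≤ (f.toFun aᶜ)ᶜ := by
  rw [le_compl_iff_disjoint_right, disjoint_iff, ← f.map_inf, inf_compl_self, f.map_bot]

theorem prec_of_prec (f : Hom A B) {a b : A} (h : A.prec a b) :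
    B.prec (f.toFun a) (f.toFun b) :=
  B.isProx.dv3 _ _ _ _ (f.toFun_le_compl a) (f.map_prec a b h) le_rfl

/-- The underlying map of the composite `g ⋆ f` (first `f`, then `g`) of de Vries morphisms. -/
def starFun (g : Hom B C) (f : Hom A B) (b : A) : C :=
  sSup {y | ∃ a, A.prec a b ∧ y = g.toFun (f.toFun a)}

theorem le_starFun (g : Hom B C) (f : Hom A B) {a b : A} (h : A.prec a b) :
    g.toFun (f.toFun a) ≤ starFun g f b := le_sSup ⟨a, h, rfl⟩

theorem starFun_le (g : Hom B C) (f : Hom A B) {b : A} {c : C}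
    (h : ∀ a, A.prec a b → g.toFun (f.toFun a) ≤ c) : starFun g f b ≤ c :=
  sSup_le (by rintro _ ⟨a, ha, rfl⟩; exact h a ha)

theorem starFun_le_apply (g : Hom B C) (f : Hom A B) (b : A) :
    starFun g f b ≤ g.toFun (f.toFun b) :=
  starFun_le g f fun _ ha => g.mono (f.mono (A.isProx.dv2 _ _ ha))

theorem starFun_mono (g : Hom B C) (f : Hom A B) {b c : A} (h : b ≤ c) :
    starFun g f b ≤ starFun g f c :=
  starFun_le g f fun _ ha => le_starFun g f (A.isProx.dv3 _ _ _ _ le_rfl ha h)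

/-- The composite `g ⋆ f` of de Vries morphisms:
`(g ⋆ f) b` is the join of all `g (f a)` with `a ≺ b`. -/
def star (g : Hom B C) (f : Hom A B) : Hom A C where
  toFun := starFun g f
  map_bot := le_bot_iff.1 <| (starFun_le_apply g f ⊥).trans (by rw [f.map_bot, g.map_bot])
  map_inf a b := by
    refine le_antisymm
      (le_inf (starFun_mono g f inf_le_left) (starFun_mono g f inf_le_right)) ?_
    unfold starFun
    rw [sSup_inf_sSup]
    refine iSup₂_le ?_
    rintro ⟨_, _⟩ ⟨⟨x, hx, rfl⟩, ⟨y, hy, rfl⟩⟩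
    refine le_sSup ⟨x ⊓ y, ?_, ?_⟩
    · exact A.isProx.dv4 _ _ _ (A.isProx.dv3 _ _ _ _ inf_le_left hx le_rfl)
        (A.isProx.dv3 _ _ _ _ inf_le_right hy le_rfl)
    · simp only [f.map_inf, g.map_inf]
  map_prec a b h := by
    obtain ⟨c, hac, hcb⟩ := A.isProx.dv6 _ _ h
    obtain ⟨d, hcd, hdb⟩ := A.isProx.dv6 _ _ hcb
    have h1 := g.map_prec _ _ (f.map_prec c d hcd)
    rw [compl_compl] at h1
    exact C.isProx.dv3 _ _ _ _ (compl_le_compl (le_starFun g f (A.isProx.dv5 _ _ hac))) h1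
      (le_starFun g f hdb)
  map_approx b := by
    refine le_antisymm (starFun_le g f fun a ha => ?_) (sSup_le ?_)
    · obtain ⟨c, hac, hcb⟩ := A.isProx.dv6 _ _ ha
      exact (le_starFun g f hac).trans (le_sSup ⟨c, hcb, rfl⟩)
    · rintro _ ⟨a, ha, rfl⟩
      exact starFun_mono g f (A.isProx.dv2 _ _ ha)

/-- The identity map as a de Vries morphism. -/
def id (A : DeV.{u}) : Hom A A where
  toFun := fun a => a
  map_bot := rfl
  map_inf _ _ := rfl
  map_prec a b h := by rwa [compl_compl]
  map_approx b := A.sSup_prec b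

theorem id_star (f : Hom A B) : star (id B) f = f := by
  ext b; exact (f.map_approx b).symm

theorem star_id (f : Hom A B) : star f (id A) = f := by
  ext b; exact (f.map_approx b).symm

theorem star_assoc (h : Hom C D) (g : Hom B C) (f : Hom A B) :
    star h (star g f) = star (star h g) f := by
  ext b
  refine le_antisymm (starFun_le _ _ fun a ha => ?_) (starFun_le _ _ fun a ha => ?_)
  · obtain ⟨c, hac, hcb⟩ := A.isProx.dv6 _ _ ha
    refine (h.mono (starFun_le_apply g f a)).trans ?_
    exact (le_starFun h g (f.prec_of_prec hac)).trans (le_starFun (star h g) f hcb)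
  · obtain ⟨c, hac, hcb⟩ := A.isProx.dv6 _ _ ha
    refine (starFun_le_apply h g _).trans ?_
    exact (h.mono (le_starFun g f hac)).trans (le_starFun h (star g f) hcb)

end Hom

/-- The category of de Vries algebras and de Vries morphisms, with composition `⋆`. -/
instance : Category DeV.{u} where
  Hom := Hom
  id := Hom.id
  comp f g := Hom.star g f
  id_comp := Hom.star_id
  comp_id := Hom.id_star
  assoc f g h := Hom.star_assoc h g f

/-- The map underlying a morphism of `DeV`. -/
abbrev fn {A B : DeV.{u}} (f : A ⟶ B) : A → B := Hom.toFun f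

end DeV

/-! ## Complete and atomic Boolean algebras -/

/-- A complete and atomic Boolean algebra. -/
structure CABA : Type (u + 1) where
  carrier : Type u
  [str : CompleteBooleanAlgebra carrier]
  [atomic : IsAtomic carrier]

namespace CABA

instance : CoeSort CABA.{u} (Type u) := ⟨CABA.carrier⟩

instance (B : CABA.{u}) : CompleteBooleanAlgebra B := B.str

instance (B : CABA.{u}) : IsAtomic B := B.atomic

/-- The category of complete and atomic Boolean algebras and complete Boolean homomorphisms
(maps preserving arbitrary joins and meets, hence also complements). -/
instance : Category CABA.{u} where
  Hom B C := CompleteLatticeHom B C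
  id B := CompleteLatticeHom.id B
  comp f g := CompleteLatticeHom.comp g f

/-- The map underlying a morphism of `CABA`. -/
abbrev fn {B C : CABA.{u}} (σ : B ⟶ C) : B → C := (show CompleteLatticeHom B C from σ)

theorem isDeVriesProximity_le (B : Type u) [BooleanAlgebra B] :
    IsDeVriesProximity (fun a b : B => a ≤ b) where
  dv1 := le_rfl
  dv2 _ _ h := h
  dv3 _ _ _ _ h1 h2 h3 := (h1.trans h2).trans h3
  dv4 _ _ _ := le_inf
  dv5 _ _ h := compl_le_compl h
  dv6 a _ h := ⟨a, le_rfl, h⟩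
  dv7 b hb := ⟨b, hb, le_rfl⟩

/-- The atomic extremally disconnected de Vries algebra `(B, ≤)`. -/
def toDeV (B : CABA.{u}) : DeV.{u} where
  carrier := B
  prec a b := a ≤ b
  isProx := isDeVriesProximity_le B

end CABA

/-! ## De Vries extensions -/

/-- `α[A]` is join-meet dense in `B`: each element of `B` is a join of meets from `α[A]`. -/
def JoinMeetDense {A B : DeV.{u}} (α : A ⟶ B) : Prop :=
  ∀ b : B, ∃ S : Set B, (∀ s ∈ S, ∃ M : Set B, M ⊆ Set.range (DeV.fn α) ∧ s = sInf M) ∧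
    b = sSup S

/-- A de Vries extension `α : A → B`. -/
structure IsDeVriesExtension {A : DeV.{u}} {B : CABA.{u}} (α : A ⟶ B.toDeV) : Prop where
  injective : Function.Injective (DeV.fn α)
  dense : JoinMeetDense α

/-- The type of de Vries extensions. -/
structure DeVe : Type (u + 1) where
  base : DeV.{u}
  top : CABA.{u}
  map : base ⟶ top.toDeV
  isExt : IsDeVriesExtension map

namespace DeVe

/-- The map underlying a de Vries extension. -/
abbrev fn (E : DeVe.{u}) : E.base → E.top := DeV.fn E.map

/-- A morphism of de Vries extensions: a pair `(ρ, σ)` of a de Vries morphism and a complete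
Boolean homomorphism with `σ ∘ α = α' ⋆ ρ`. -/
@[ext]
structure Hom (E E' : DeVe.{u}) : Type u where
  ρ : E.base ⟶ E'.base
  σ : E.top ⟶ E'.top
  comm : ∀ a, CABA.fn σ (E.fn a) = DeV.fn (ρ ≫ E'.map) a

/-- A complete Boolean homomorphism may be moved inside a star composite. -/
theorem comp_eq {E₁ E₂ E₃ : DeVe.{u}} (f : Hom E₁ E₂) (g : Hom E₂ E₃) (a : E₁.base) :
    CABA.fn (f.σ ≫ g.σ) (E₁.fn a) = DeV.fn ((f.ρ ≫ g.ρ) ≫ E₃.map) a := by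
  rw [Category.assoc]
  change CABA.fn g.σ (CABA.fn f.σ (E₁.fn a)) = _
  rw [f.comm a]
  have key : ∀ S : Set E₂.top, CABA.fn g.σ (sSup S) = sSup (CABA.fn g.σ '' S) :=
    fun S => map_sSup (show CompleteLatticeHom E₂.top E₃.top from g.σ) S
  refine (key _).trans ?_
  refine le_antisymm (sSup_le ?_) (sSup_le ?_)
  · rintro _ ⟨_, ⟨x, hx, rfl⟩, rfl⟩
    exact le_sSup ⟨x, hx, g.comm _⟩
  · rintro _ ⟨x, hx, rfl⟩
    exact le_sSup ⟨_, ⟨x, hx, rfl⟩, g.comm _⟩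

/-- The category of de Vries extensions; morphisms are composed componentwise,
by `⋆` and by `∘`. -/
instance : Category DeVe.{u} where
  Hom := Hom
  id E := { ρ := 𝟙 _, σ := 𝟙 _, comm := fun a => by rw [Category.id_comp]; rfl }
  comp f g := { ρ := f.ρ ≫ g.ρ, σ := f.σ ≫ g.σ, comm := comp_eq f g }
  id_comp f := Hom.ext (Category.id_comp f.ρ) (Category.id_comp f.σ)
  comp_id f := Hom.ext (Category.comp_id f.ρ) (Category.comp_id f.σ)
  assoc f g h := Hom.ext (Category.assoc f.ρ g.ρ h.ρ) (Category.assoc f.σ g.σ h.σ)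

/-- The functor sending `α : A → B` to `A`. -/
def baseFunctor : DeVe.{u} ⥤ DeV.{u} where
  obj E := E.base
  map f := Hom.ρ f

/-- The functor sending `α : A → B` to `B`. -/
def topFunctor : DeVe.{u} ⥤ CABA.{u} where
  obj E := E.top
  map f := Hom.σ f

/-- A de Vries extension `α : A → B` is maximal if every compatible extension `γ : C → B`
(that is, one with `γ[C] = α[A]`) has the form `γ = α ⋆ δ` for a de Vries morphism `δ : C → A`. -/
def IsMaximal : ObjectProperty DeVe.{u} := fun E =>
  ∀ (C : DeV.{u}) (γ : C ⟶ E.top.toDeV), IsDeVriesExtension γ →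
    Set.range (DeV.fn E.map) = Set.range (DeV.fn γ) → ∃ δ : C ⟶ E.base, δ ≫ E.map = γ

end DeVe

/-- The full subcategory of maximal de Vries extensions. -/
abbrev MDeVe : Type (u + 1) := DeVe.IsMaximal.{u}.FullSubcategory

/-! ## Completely regular spaces -/

/-- The category of completely regular (Hausdorff) spaces and continuous maps. -/
abbrev CReg : Type (u + 1) :=
  ObjectProperty.FullSubcategory (fun X : TopCat.{u} => T35Space X)

namespace CReg

/-- The Stone–Čech compactification functor on completely regular spaces. -/
noncomputable def beta : CReg.{u} ⥤ CompHaus.{u} := ObjectProperty.ι _ ⋙ topToCompHaus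

/-- The canonical map `s : X → βX`. -/
def s (X : CReg.{u}) : X.obj → beta.obj X := (stoneCechUnit : X.obj → StoneCech X.obj)

/-- The underlying-set functor. -/
def points : CReg.{u} ⥤ Type u := ObjectProperty.ι _ ⋙ forget TopCat.{u}

theorem t35Space_of_compact (X : Type u) [TopologicalSpace X] [CompactSpace X] [T2Space X] :
    T35Space X := inferInstance

theorem t35Space_of_discrete (X : Type u) [TopologicalSpace X] [DiscreteTopology X] :
    T35Space X := inferInstance

/-- The inclusion of compact Hausdorff spaces. -/
def ofCompHaus : CompHaus.{u} ⥤ CReg.{u} :=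
  ObjectProperty.lift _ compHausToTop fun X =>
    t35Space_of_compact X

/-- Sets as discrete spaces. -/
def ofSet : Type u ⥤ CReg.{u} :=
  ObjectProperty.lift _ TopCat.discrete fun X =>
    have : DiscreteTopology (TopCat.discrete.obj X) := ⟨rfl⟩
    t35Space_of_discrete _

end CReg

/-! ## Regular open sets and the functors of de Vries and Tarski duality -/

/-- The regular open subsets of `X`: the open sets `U` with `Uᶜᶜ = U`, where `Uᶜ` is the
pseudocomplement (the interior of the set complement) of `U` in the lattice of open sets. -/
abbrev RegularOpen (X : Type u) [TopologicalSpace X] : Type u := Heyting.Regular (Opens X)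

namespace RegularOpen

open Heyting.Regular

variable {X Y : Type u} [TopologicalSpace X] [TopologicalSpace Y]

theorem coe_compl_opens (U : Opens X) : ((Uᶜ : Opens X) : Set X) = interior ((U : Set X)ᶜ) := by
  ext x
  constructor
  · intro hx
    refine mem_interior.2 ⟨_, ?_, (Uᶜ).isOpen, hx⟩
    intro y hy hyU
    exact (disjoint_compl_left (a := U)).le_bot (⟨hy, hyU⟩ : y ∈ (Uᶜ ⊓ U : Opens X))
  · intro hx
    have : (⟨interior ((U : Set X)ᶜ), isOpen_interior⟩ : Opens X) ≤ Uᶜ := by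
      rw [le_compl_iff_disjoint_right, disjoint_iff_inf_le]
      rintro y ⟨hy, hyU⟩
      exact (interior_subset hy hyU).elim
    exact this hx

theorem coe_compl_compl (U : Opens X) :
    ((Uᶜᶜ : Opens X) : Set X) = interior (closure (U : Set X)) := by
  rw [coe_compl_opens, coe_compl_opens, ← closure_compl, compl_compl]

/-- `Heyting.Regular (Opens X)` consists of the open sets with `int (cl U) = U`. -/
theorem isRegular_iff (U : Opens X) :
    Heyting.IsRegular U ↔ interior (closure (U : Set X)) = U := by
  rw [← coe_compl_compl, SetLike.coe_set_eq]; rfl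

/-- The complete Boolean algebra of regular open sets: the join of a family is `int (cl (⋃ U))`
and the meet is the interior of the intersection. -/
instance : CompleteBooleanAlgebra (RegularOpen X) :=
  { (inferInstance : BooleanAlgebra (RegularOpen X)) with
    sSup := fun S => toRegular (sSup (Heyting.Regular.val '' S))
    sInf := fun S => toRegular (sInf (Heyting.Regular.val '' S))
    isLUB_sSup := fun S => ⟨fun U hU => by
        rw [← coe_le_coe]
        exact (le_sSup (Set.mem_image_of_mem _ hU)).trans le_compl_compl,
      fun V hV => by
        rw [← toRegular_coe V]
        exact toRegular.monotone (sSup_le (by rintro _ ⟨U, hU, rfl⟩; exact hV hU))⟩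
    isGLB_sInf := fun S => ⟨fun U hU => by
        rw [← toRegular_coe U]
        exact toRegular.monotone (sInf_le (Set.mem_image_of_mem _ hU)),
      fun V hV => by
        rw [← toRegular_coe V]
        exact toRegular.monotone (le_sInf (by rintro _ ⟨U, hU, rfl⟩; exact hV hU))⟩ }

/-- The set of points of a regular open set. -/
abbrev pts (U : RegularOpen X) : Set X := (U.val : Set X)

theorem pts_le {U V : RegularOpen X} : U ≤ V ↔ U.pts ⊆ V.pts := Iff.rfl

theorem isOpen_pts (U : RegularOpen X) : IsOpen U.pts := U.val.isOpen

theorem pts_compl (U : RegularOpen X) : (Uᶜ).pts = interior (U.pts)ᶜ := coe_compl_opens _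

theorem pts_bot : (⊥ : RegularOpen X).pts = ∅ := rfl

theorem interior_closure_pts (U : RegularOpen X) : interior (closure U.pts) = U.pts :=
  (isRegular_iff _).1 U.prop

/-- The regularization `int (cl S)` of an open set. -/
def reg (S : Set X) (h : IsOpen S) : RegularOpen X := toRegular ⟨S, h⟩

theorem pts_reg (S : Set X) (h : IsOpen S) : (reg S h).pts = interior (closure S) :=
  coe_compl_compl _

theorem subset_reg (S : Set X) (h : IsOpen S) : S ⊆ (reg S h).pts := by
  rw [pts_reg]; exact interior_maximal subset_closure h

theorem reg_le {S : Set X} {h : IsOpen S} {U : RegularOpen X} (hS : S ⊆ U.pts) :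
    reg S h ≤ U := by
  rw [pts_le, pts_reg, ← interior_closure_pts U]
  exact interior_mono (closure_mono hS)

/-- The canonical proximity: `U ≺ V` iff `cl U ⊆ V`. -/
def Prec (U V : RegularOpen X) : Prop := closure U.pts ⊆ V.pts

theorem exists_prec [CompactSpace X] [T2Space X] (V : RegularOpen X) {x : X} (hx : x ∈ V.pts) :
    ∃ U : RegularOpen X, x ∈ U.pts ∧ Prec U V := by
  obtain ⟨F, hF, hFc, hFV⟩ := exists_mem_nhds_isClosed_subset (V.isOpen_pts.mem_nhds hx)
  refine ⟨reg (interior F) isOpen_interior,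
    subset_reg _ _ (mem_interior_iff_mem_nhds.2 hF), ?_⟩
  refine (closure_minimal ?_ hFc).trans hFV
  rw [pts_reg]
  exact interior_subset.trans (closure_minimal interior_subset hFc)

theorem isDeVriesProximity_prec [CompactSpace X] [T2Space X] :
    IsDeVriesProximity (Prec : RegularOpen X → RegularOpen X → Prop) where
  dv1 := Set.subset_univ _
  dv2 _ _ h := subset_closure.trans h
  dv3 _ _ _ _ h1 h2 h3 := (closure_mono h1).trans (h2.trans h3)
  dv4 _ _ _ h1 h2 := Set.subset_inter h1 h2
  dv5 U V h := by
    change closure (Vᶜ).pts ⊆ (Uᶜ).pts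
    rw [pts_compl, pts_compl, interior_compl, interior_compl, closure_compl,
      Set.compl_subset_compl]
    exact h.trans (interior_maximal subset_closure V.isOpen_pts)
  dv6 U V h := by
    obtain ⟨W, hWo, hUW, hWV⟩ := normal_exists_closure_subset isClosed_closure V.isOpen_pts h
    refine ⟨reg W hWo, hUW.trans (subset_reg _ _), (closure_minimal ?_ isClosed_closure).trans hWV⟩
    rw [pts_reg]; exact interior_subset
  dv7 V hV := by
    have : V.pts.Nonempty := by
      rw [Set.nonempty_iff_ne_empty]
      intro h0
      exact hV (le_bot_iff.1 (pts_le.2 (by rw [h0]; exact Set.empty_subset _)))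
    obtain ⟨x, hx⟩ := this
    obtain ⟨U, hxU, hUV⟩ := exists_prec V hx
    refine ⟨U, ?_, hUV⟩
    rintro rfl
    exact hxU

/-- The map `f^*(U) = int (cl (f⁻¹ U))` on regular open sets. -/
def pullback (f : X → Y) (hf : Continuous f) (U : RegularOpen Y) : RegularOpen X :=
  reg (f ⁻¹' U.pts) (U.isOpen_pts.preimage hf)

theorem pts_pullback (f : X → Y) (hf : Continuous f) (U : RegularOpen Y) :
    (pullback f hf U).pts = interior (closure (f ⁻¹' U.pts)) := pts_reg _ _

theorem pts_pullback_subset (f : X → Y) (hf : Continuous f) {U V : RegularOpen Y}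
    (h : Prec U V) : (pullback f hf U).pts ⊆ f ⁻¹' V.pts := by
  rw [pts_pullback]
  refine interior_subset.trans ((closure_minimal ?_ (isClosed_closure.preimage hf)).trans
    (Set.preimage_mono h))
  exact Set.preimage_mono subset_closure

theorem pullback_mono (f : X → Y) (hf : Continuous f) {U V : RegularOpen Y} (h : U ≤ V) :
    pullback f hf U ≤ pullback f hf V :=
  reg_le ((Set.preimage_mono (pts_le.1 h)).trans (subset_reg _ _))

/-- If `f⁻¹ U ⊆ T U` for all `U`, then `f^*(V)` is at most the join of all `T U` with `U ≺ V`. -/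
theorem pullback_le_sSup [CompactSpace Y] [T2Space Y] (f : X → Y) (hf : Continuous f)
    (V : RegularOpen Y) (T : RegularOpen Y → RegularOpen X) (hT : ∀ U, f ⁻¹' U.pts ⊆ (T U).pts) :
    pullback f hf V ≤ sSup {W | ∃ U, Prec U V ∧ W = T U} := by
  refine reg_le fun x hx => ?_
  obtain ⟨U, hxU, hUV⟩ := exists_prec V (show f x ∈ V.pts from hx)
  have hle : T U ≤ sSup {W | ∃ U, Prec U V ∧ W = T U} := le_sSup ⟨U, hUV, rfl⟩
  exact pts_le.1 hle (hT U hxU)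

theorem pullback_bot (f : X → Y) (hf : Continuous f) : pullback f hf ⊥ = ⊥ :=
  le_bot_iff.1 (reg_le (U := ⊥) (Set.Subset.refl (∅ : Set X)))

theorem pullback_inf (f : X → Y) (hf : Continuous f) (U V : RegularOpen Y) :
    pullback f hf (U ⊓ V) = pullback f hf U ⊓ pullback f hf V :=
  coe_injective (compl_compl_inf_distrib (⟨f ⁻¹' U.pts, U.isOpen_pts.preimage hf⟩ : Opens X)
    (⟨f ⁻¹' V.pts, V.isOpen_pts.preimage hf⟩ : Opens X))

theorem pullback_prec (f : X → Y) (hf : Continuous f) (U V : RegularOpen Y) (h : Prec U V) :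
    Prec (pullback f hf Uᶜ)ᶜ (pullback f hf V) := by
  refine Set.Subset.trans (closure_minimal ?_ (isClosed_closure.preimage hf))
    ((Set.preimage_mono h).trans (subset_reg _ (V.isOpen_pts.preimage hf)))
  rw [pts_compl]
  refine interior_subset.trans ?_
  rw [Set.compl_subset_comm, ← Set.preimage_compl, ← interior_compl, ← pts_compl]
  exact subset_reg _ _

theorem pullback_approx [CompactSpace Y] [T2Space Y] (f : X → Y) (hf : Continuous f)
    (V : RegularOpen Y) :
    pullback f hf V = sSup {W | ∃ U, Prec U V ∧ W = pullback f hf U} := by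
  refine le_antisymm (pullback_le_sSup f hf V _ fun U => subset_reg _ _) (sSup_le ?_)
  rintro _ ⟨U, hU, rfl⟩
  exact pullback_mono f hf (subset_closure.trans hU)

theorem pullback_id (U : RegularOpen X) : pullback (fun x => x) continuous_id U = U :=
  toRegular_coe U

theorem pullback_comp {Z : Type u} [TopologicalSpace Z] [CompactSpace Z] [T2Space Z]
    (f : X → Y) (hf : Continuous f) (g : Y → Z) (hg : Continuous g) (V : RegularOpen Z) :
    pullback (fun x => g (f x)) (hg.comp hf) V =
      sSup {W | ∃ U, Prec U V ∧ W = pullback f hf (pullback g hg U)} := by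
  refine le_antisymm (pullback_le_sSup _ _ V (fun U => pullback f hf (pullback g hg U))
    fun U x hx => ?_) (sSup_le ?_)
  · exact subset_reg _ _ (subset_reg (g ⁻¹' U.pts) (U.isOpen_pts.preimage hg) hx)
  · rintro _ ⟨U, hU, rfl⟩
    refine reg_le (Set.Subset.trans ?_ (subset_reg _ _))
    exact Set.preimage_mono (f := f) (pts_pullback_subset g hg hU)

end RegularOpen

namespace CompHaus

/-- The de Vries algebra `(RO(Y), ≺)` of a compact Hausdorff space. -/
def regularOpens (Y : CompHaus.{u}) : DeV.{u} where
  carrier := RegularOpen Y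
  prec := RegularOpen.Prec
  isProx := RegularOpen.isDeVriesProximity_prec

/-- The de Vries morphism `f^* : RO(Y) → RO(X)`, `f^*(U) = int (cl (f⁻¹ U))`, of a continuous
map `f : X → Y`. -/
def pullback {X Y : CompHaus.{u}} (f : X ⟶ Y) : DeV.Hom Y.regularOpens X.regularOpens where
  toFun := RegularOpen.pullback f f.hom.hom.continuous
  map_bot := RegularOpen.pullback_bot _ _
  map_inf := RegularOpen.pullback_inf _ _
  map_prec := RegularOpen.pullback_prec _ _
  map_approx := RegularOpen.pullback_approx _ _

end CompHaus

/-- The contravariant functor `(-)^*` of de Vries duality. -/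
def deVriesDual : CompHaus.{u}ᵒᵖ ⥤ DeV.{u} where
  obj Y := Y.unop.regularOpens
  map f := CompHaus.pullback f.unop
  map_id _ := DeV.Hom.ext (funext RegularOpen.pullback_id)
  map_comp f g := DeV.Hom.ext (funext (RegularOpen.pullback_comp
    g.unop g.unop.hom.hom.continuous f.unop f.unop.hom.hom.continuous))

/-- The contravariant functor of Tarski duality: `X ↦ ℘(X)` and `f ↦ f⁻¹`. -/
def tarskiDual : (Type u)ᵒᵖ ⥤ CABA.{u} where
  obj X := { carrier := Set X.unop }
  map f := CompleteLatticeHom.setPreimage f.unop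

/-! ## Complete atomic Boolean algebras as maximal de Vries extensions -/

/-- The identity `(B, ≤) → (B, ≤)`, as a maximal de Vries extension. -/
def CABA.idExtension (B : CABA.{u}) : MDeVe.{u} where
  obj :=
    { base := B.toDeV
      top := B
      map := 𝟙 _
      isExt :=
        ⟨fun _ _ h => h, fun b => ⟨{b}, fun s _ => ⟨{s}, fun x _ => ⟨x, rfl⟩, sInf_singleton.symm⟩,
          sSup_singleton.symm⟩⟩ }
  property := fun _ γ _ _ => ⟨γ, Category.comp_id γ⟩

section

variable {B C : Type u} [CompleteBooleanAlgebra B] [CompleteBooleanAlgebra C]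
  (σ : CompleteLatticeHom B C)

theorem CABA.map_bot_of : σ ⊥ = ⊥ := map_bot σ

theorem CABA.map_inf_of (a b : B) : σ (a ⊓ b) = σ a ⊓ σ b := map_inf σ a b

theorem CABA.map_prec_of (a b : B) (h : a ≤ b) : (σ aᶜ)ᶜ ≤ σ b := by
  rw [map_compl' σ, compl_compl]
  exact OrderHomClass.mono σ h

theorem CABA.map_approx_of (b : B) : σ b = sSup {y | ∃ a, a ≤ b ∧ y = σ a} :=
  le_antisymm (le_sSup ⟨b, le_rfl, rfl⟩) (sSup_le (by
    rintro _ ⟨a, ha, rfl⟩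
    exact OrderHomClass.mono σ ha))

end

/-- A complete Boolean homomorphism, as a de Vries morphism `(B, ≤) → (C, ≤)`. -/
def CABA.homToDeV {B C : CABA.{u}} (σ : B ⟶ C) : DeV.Hom B.toDeV C.toDeV :=
  { toFun := CABA.fn σ
    map_bot := CABA.map_bot_of (B := B) (C := C) σ
    map_inf := CABA.map_inf_of (B := B) (C := C) σ
    map_prec := CABA.map_prec_of (B := B) (C := C) σ
    map_approx := CABA.map_approx_of (B := B) (C := C) σ }

/-- The functor that sends `B` to the identity of `(B, ≤)` and `σ` to `(σ, σ)`. -/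
def CABA.toMDeVe : CABA.{u} ⥤ MDeVe.{u} where
  obj := CABA.idExtension
  map {B C} σ := ObjectProperty.homMk
    { ρ := CABA.homToDeV σ
      σ := σ
      comm := fun b => congrArg (fun h => DeV.Hom.toFun h b)
        (Category.comp_id (show B.toDeV ⟶ C.toDeV from CABA.homToDeV σ)).symm }
  map_id _ := ObjectProperty.hom_ext _ (DeVe.Hom.ext rfl rfl)
  map_comp {B C D} σ τ := ObjectProperty.hom_ext _ (DeVe.Hom.ext (DeV.Hom.ext (funext fun b =>
    le_antisymm (le_sSup ⟨b, le_refl (α := B) b, rfl⟩) (sSup_le (by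
      rintro _ ⟨a, ha, rfl⟩
      exact DeV.Hom.mono (CABA.homToDeV (σ ≫ τ)) ha)))) rfl)

namespace MDeVe

/-- The functor sending `α : A → B` to the de Vries algebra `A`. -/
def baseFunctor : MDeVe.{u} ⥤ DeV.{u} := ObjectProperty.ι _ ⋙ DeVe.baseFunctor

/-- The functor sending `α : A → B` to the complete atomic Boolean algebra `B`. -/
def topFunctor : MDeVe.{u} ⥤ CABA.{u} := ObjectProperty.ι _ ⋙ DeVe.topFunctor

end MDeVe

/-- The map `s⁻¹ : RO(βX) → ℘(X)` of the Stone–Čech compactification `s : X → βX`. -/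
def CReg.pullbackS (X : CReg.{u}) (U : deVriesDual.obj (op (CReg.beta.obj X))) :
    tarskiDual.obj (op (CReg.points.obj X)) :=
  show Set X.obj from CReg.s X ⁻¹' RegularOpen.pts (X := CReg.beta.obj X) U

/-! ## Morphisms and isomorphisms of de Vries algebras -/

namespace DeV

variable {A B C : DeV.{u}}

/-! A de Vries morphism from `A` to a powerset `℘(X)` is the same thing as a map from `X` to the
space of points of `A`: a point `x` corresponds to the round filter of all `a` whose value contains
`x`. The points of `A` form a compact Hausdorff space `Y` with `A ≅ RO(Y)` (`pointIso`), and the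
points of `RO(Y)` are those of `Y` (`exists_point_eq`). So every de Vries morphism `RO(Y) → ℘(X)` is
`f⁻¹` for a unique function `f : X → Y`, and composition with `g^*` gives `(g ∘ f)⁻¹`
(`exists_eq_preim`, `map_comp_preim`). De Vries duality follows by taking `X = Y` as a set.

The morphism `f⁻¹` is injective iff `f` has dense range, and its image is join-meet dense iff `f` is
injective. Since complete atomic Boolean algebras are powersets (Tarski), a de Vries extension is a
compactification of the set `X` with the topology induced by `f`. Its image consists of the regular
open sets of that topology and hence determines the topology, so compatible extensions are
compactifications of the same space and the maximal one is Stone–Čech (`exists_comp_preim_s_eq`).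
Maximal extensions with the same image are isomorphic (`MDeVe.nonempty_iso`), which gives essential
surjectivity.

For fullness, a morphism `(ρ, σ)` has `σ = f⁻¹`. Compatibility makes the inverse images of basic
open sets open, so `f` is continuous, and `ρ` is determined because extensions are monomorphisms.
For compact `X` one has `βX ≅ X`, and for discrete `X` the morphism `s⁻¹` is an isomorphism. -/

theorem prec_sup {a b c : A} (ha : A.prec a c) (hb : A.prec b c) : A.prec (a ⊔ b) c := by
  have h := A.isProx.dv5 _ _ (A.isProx.dv4 _ _ _ (A.isProx.dv5 _ _ ha) (A.isProx.dv5 _ _ hb))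
  rwa [compl_compl, compl_inf, compl_compl, compl_compl] at h

theorem prec_of_le_of_prec {a b c : A} (hab : a ≤ b) (hbc : A.prec b c) : A.prec a c :=
  A.isProx.dv3 _ _ _ _ hab hbc le_rfl

theorem prec_of_prec_of_le {a b c : A} (hab : A.prec a b) (hbc : b ≤ c) : A.prec a c :=
  A.isProx.dv3 _ _ _ _ le_rfl hab hbc

theorem hom_ext {f g : A ⟶ B} (h : ∀ a, fn f a = fn g a) : f = g :=
  Hom.ext (funext h)

theorem comp_apply_le (f : A ⟶ B) (g : B ⟶ C) (a : A) : fn (f ≫ g) a ≤ fn g (fn f a) :=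
  Hom.starFun_le_apply g f a

theorem apply_le_comp (f : A ⟶ B) (g : B ⟶ C) {a b : A} (h : A.prec a b) :
    fn g (fn f a) ≤ fn (f ≫ g) b :=
  Hom.le_starFun g f h

theorem le_of_forall_prec {b : A} {f : A ⟶ B} {c : B} (h : ∀ a, A.prec a b → fn f a ≤ c) :
    fn f b ≤ c :=
  (Hom.map_approx f b).le.trans (sSup_le (by rintro _ ⟨a, ha, rfl⟩; exact h a ha))

theorem le_of_apply_le {f : A ⟶ B} (hf : Function.Injective (fn f)) {a b : A}
    (h : fn f a ≤ fn f b) : a ≤ b :=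
  inf_eq_left.1 (hf ((Hom.map_inf f a b).trans (inf_eq_left.2 h)))

/-- Since `⋆` is not pointwise composition, injectivity cannot be applied directly. Equal composites
only compare `g b` with `h a` for `b ≺ a`; `f` reflects order, and the join over all such `b` gives
`g a ≤ h a`. -/
theorem mono_of_injective {f : A ⟶ B} (hf : Function.Injective (fn f)) : Mono f where
  right_cancellation {Z} g h w := by
    have key : ∀ g h : Z ⟶ A, g ≫ f = h ≫ f → ∀ a, fn g a ≤ fn h a := fun g h w a =>
      le_of_forall_prec fun b hb => le_of_apply_le hf <|
        (apply_le_comp g f hb).trans ((congrArg (fun k => fn k a) w).le.trans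
          (comp_apply_le h f a))
    exact hom_ext fun a => le_antisymm (key g h w a) (key h g w.symm a)

/-- A bijection that preserves and reflects order and proximity, as a de Vries morphism. -/
def homOfOrderIso (e : A ≃o B) (h : ∀ a b, A.prec a b ↔ B.prec (e a) (e b)) : A ⟶ B :=
  { toFun := e
    map_bot := map_bot e
    map_inf := map_inf e
    map_prec := fun a b hab => by
      rw [map_compl' e, compl_compl]
      exact (h a b).1 hab
    map_approx := fun b => by
      refine (B.sSup_prec (e b)).trans (congrArg sSup (Set.ext fun y => ?_))
      constructor
      · rintro ⟨c, hc, rfl⟩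
        exact ⟨e.symm y, (h _ _).2 (by rwa [e.apply_symm_apply]), (e.apply_symm_apply y).symm⟩
      · rintro ⟨a, ha, rfl⟩
        exact ⟨e a, (h _ _).1 ha, rfl⟩ }

/-- A bijection that preserves and reflects order and proximity is an isomorphism. -/
def isoOfOrderIso (e : A ≃o B) (h : ∀ a b, A.prec a b ↔ B.prec (e a) (e b)) : A ≅ B where
  hom := homOfOrderIso e h
  inv := homOfOrderIso e.symm fun a b => by
    rw [h, e.apply_symm_apply, e.apply_symm_apply]
  hom_inv_id := hom_ext fun b => by
    refine Eq.trans (congrArg sSup (Set.ext fun y => ?_)) (A.sSup_prec b).symm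
    refine exists_congr fun a => and_congr_right fun _ => ?_
    exact Eq.congr_right (e.symm_apply_apply a)
  inv_hom_id := hom_ext fun b => by
    refine Eq.trans (congrArg sSup (Set.ext fun y => ?_)) (B.sSup_prec b).symm
    refine exists_congr fun a => and_congr_right fun _ => ?_
    exact Eq.congr_right (e.apply_symm_apply a)

/-- The `⋆`-composite lies below the pointwise one, which gives one inequality. The other is the
same inequality at `aᶜ`, because a de Vries morphism sends `aᶜ` below the complement of the image of
`a`. -/
theorem inv_apply_hom_apply (e : A ≅ B) (a : A) : fn e.inv (fn e.hom a) = a := by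
  have h : ∀ a, a ≤ fn e.inv (fn e.hom a) := fun a =>
    (congrArg (fun k => fn k a) e.hom_inv_id).ge.trans (comp_apply_le _ _ a)
  refine le_antisymm ?_ (h a)
  rw [← compl_le_compl_iff_le]
  refine (h aᶜ).trans ((Hom.mono e.inv (Hom.toFun_le_compl e.hom aᶜ)).trans ?_)
  rw [compl_compl]
  refine (Hom.toFun_le_compl e.inv _).trans ?_
  rw [compl_compl]

/-- An isomorphism reflects proximity, so every `b ≺ e a` is the image of some element proximal to
`a`. -/
theorem hom_comp_apply (e : A ≅ B) (f : B ⟶ C) (a : A) :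
    fn (e.hom ≫ f) a = fn f (fn e.hom a) := by
  refine le_antisymm (comp_apply_le _ _ a) (le_of_forall_prec fun b hb => ?_)
  have h := Hom.prec_of_prec e.inv hb
  rw [show e.inv.toFun (fn e.hom a) = a from inv_apply_hom_apply e a] at h
  have h' := apply_le_comp e.hom f h
  rwa [show fn e.hom (e.inv.toFun b) = b from inv_apply_hom_apply e.symm b] at h'

theorem hom_injective (e : A ≅ B) : Function.Injective (fn e.hom) :=
  Function.LeftInverse.injective (inv_apply_hom_apply e)

theorem hom_surjective (e : A ≅ B) : Function.Surjective (fn e.hom) := fun b =>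
  ⟨fn e.inv b, inv_apply_hom_apply e.symm b⟩

theorem range_hom_comp (e : A ≅ B) (f : B ⟶ C) :
    Set.range (fn (e.hom ≫ f)) = Set.range (fn f) := by
  rw [show fn (e.hom ≫ f) = fn f ∘ fn e.hom from funext (hom_comp_apply e f),
    (hom_surjective e).range_comp]

/-! ## The space of points of a de Vries algebra -/

/-- A point (an end) of a de Vries algebra: a proper round filter that contains `aᶜ` or `b`
whenever `a ≺ b`. -/
@[ext]
structure Point (A : DeV.{u}) : Type u where
  carrier : Set A
  bot_notMem : ⊥ ∉ carrier
  inf_mem : ∀ {a b}, a ∈ carrier → b ∈ carrier → a ⊓ b ∈ carrier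
  mem_of_le : ∀ {a b}, a ≤ b → a ∈ carrier → b ∈ carrier
  compl_mem_or : ∀ {a b}, A.prec a b → aᶜ ∈ carrier ∨ b ∈ carrier
  exists_prec : ∀ {b}, b ∈ carrier → ∃ a ∈ carrier, A.prec a b

namespace Point

/-- The round part of a filter that contains `aᶜ` or `b` whenever `a ≺ b` is a point. -/
def ofFilter (G : Set A) (bot_notMem : ⊥ ∉ G) (inf_mem : ∀ {a b}, a ∈ G → b ∈ G → a ⊓ b ∈ G)
    (compl_mem_or : ∀ {a b}, A.prec a b → aᶜ ∈ G ∨ b ∈ G) : Point A where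
  carrier := {b | ∃ a ∈ G, A.prec a b}
  bot_notMem := by
    rintro ⟨a, ha, h⟩
    exact bot_notMem (le_bot_iff.1 (A.isProx.dv2 _ _ h) ▸ ha)
  inf_mem := by
    rintro a b ⟨c, hc, hca⟩ ⟨d, hd, hdb⟩
    exact ⟨c ⊓ d, inf_mem hc hd, A.isProx.dv4 _ _ _ (prec_of_le_of_prec inf_le_left hca)
      (prec_of_le_of_prec inf_le_right hdb)⟩
  mem_of_le := by
    rintro a b hab ⟨c, hc, hca⟩
    exact ⟨c, hc, prec_of_prec_of_le hca hab⟩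
  compl_mem_or := by
    intro a b hab
    -- Interpolating `a ≺ c ≺ d ≺ b` and using the dichotomy for `c ≺ d` leaves the room at both
    -- ends that the round part needs.
    obtain ⟨c, hac, hcb⟩ := A.isProx.dv6 _ _ hab
    obtain ⟨d, hcd, hdb⟩ := A.isProx.dv6 _ _ hcb
    exact (compl_mem_or hcd).imp (fun h => ⟨cᶜ, h, A.isProx.dv5 _ _ hac⟩) fun h => ⟨d, h, hdb⟩
  exists_prec := by
    rintro b ⟨a, ha, hab⟩
    obtain ⟨c, hac, hcb⟩ := A.isProx.dv6 _ _ hab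
    exact ⟨c, ⟨a, ha, hac⟩, hcb⟩

theorem compl_notMem (p : Point A) {a : A} (h : a ∈ p.carrier) : aᶜ ∉ p.carrier := fun h' =>
  p.bot_notMem (inf_compl_self a ▸ p.inf_mem h h')

theorem top_mem (p : Point A) : ⊤ ∈ p.carrier :=
  (p.compl_mem_or A.isProx.dv1).elim (fun h => p.mem_of_le le_top h) fun h => h

/-- The complement of a prime ideal that omits a nonzero `b ≺ a` is an ultrafilter. Passing to its
round part may lose `b`, but keeps `a`. -/
theorem exists_mem {a : A} (ha : a ≠ ⊥) : ∃ p : Point A, a ∈ p.carrier := by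
  obtain ⟨b, hb, hba⟩ := A.isProx.dv7 a ha
  obtain ⟨J, hJ, -, hd⟩ := DistribLattice.prime_ideal_of_disjoint_filter_ideal
    (F := Order.PFilter.principal b) (I := (⊥ : Order.Ideal A)) <| by
      rw [Set.disjoint_left]
      intro x hx hx'
      have h1 : b ≤ x := hx
      have h2 : x = ⊥ := le_bot_iff.1 hx'
      exact hb (le_bot_iff.1 (h2 ▸ h1))
  have hbJ : b ∉ J := Set.disjoint_left.1 hd (show b ≤ b from le_rfl)
  have hor : ∀ {c d}, c ⊓ d ∈ J → c ∈ J ∨ d ∈ J := fun h => hJ.mem_or_mem h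
  refine ⟨ofFilter {x | x ∉ J} (fun h => h J.bot_mem) (fun hc hd h => (hor h).elim hc hd) ?_,
    b, hbJ, hba⟩
  intro c d hcd
  by_contra! hn
  simp only [Set.mem_ofPred_eq, not_not] at hn
  have htop : cᶜ ⊔ d ∈ J := J.sup_mem hn.1 hn.2
  have : b ≤ cᶜ ⊔ d := by
    have h1 : cᶜ ⊔ c ≤ cᶜ ⊔ d := sup_le_sup_left (A.isProx.dv2 _ _ hcd) _
    rw [compl_sup_eq_top] at h1
    exact le_top.trans h1
  exact hbJ (J.lower this htop)

/-- The set of points that contain `a`. -/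
def basic (a : A) : Set (Point A) := {p | a ∈ p.carrier}

theorem basic_inf (a b : A) : basic (a ⊓ b) = basic a ∩ basic b :=
  Set.ext fun p => ⟨fun h => ⟨p.mem_of_le inf_le_left h, p.mem_of_le inf_le_right h⟩,
    fun h => p.inf_mem h.1 h.2⟩

theorem basic_bot : basic (⊥ : A) = ∅ := Set.eq_empty_of_forall_notMem fun p => p.bot_notMem

theorem basic_subset_iff {a b : A} : basic a ⊆ basic b ↔ a ≤ b := by
  refine ⟨fun h => ?_, fun h p => p.mem_of_le h⟩
  by_contra hab
  rw [← sdiff_eq_bot_iff, sdiff_eq] at hab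
  obtain ⟨p, hp⟩ := exists_mem hab
  exact p.compl_notMem (h (p.mem_of_le inf_le_left hp)) (p.mem_of_le inf_le_right hp)

theorem disjoint_basic_iff {a b : A} : Disjoint (basic a) (basic b) ↔ a ≤ bᶜ := by
  rw [le_compl_iff_disjoint_right, Set.disjoint_iff_inter_eq_empty, ← basic_inf,
    Set.eq_empty_iff_forall_notMem, disjoint_iff]
  refine ⟨fun h => ?_, fun h p => h ▸ p.bot_notMem⟩
  by_contra hab
  obtain ⟨p, hp⟩ := exists_mem hab
  exact h p hp

instance : TopologicalSpace (Point A) := generateFrom (Set.range basic)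

theorem isTopologicalBasis : IsTopologicalBasis (Set.range (basic : A → Set (Point A))) where
  exists_subset_inter := by
    rintro _ ⟨a, rfl⟩ _ ⟨b, rfl⟩ p hp
    exact ⟨_, ⟨a ⊓ b, rfl⟩, by rwa [basic_inf], (basic_inf a b).le⟩
  sUnion_eq := Set.eq_univ_of_forall fun p => ⟨_, ⟨⊤, rfl⟩, p.top_mem⟩
  eq_generateFrom := rfl

theorem isOpen_basic (a : A) : IsOpen (basic a) := isTopologicalBasis.isOpen ⟨a, rfl⟩

/-- If `b` is in `p` but not in `q`, roundness gives `a ≺ b` in `p`, and then `aᶜ` is in `q`. -/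
instance : T2Space (Point A) := by
  have key : ∀ p q : Point A, ∀ b ∈ p.carrier, b ∉ q.carrier →
      ∃ a, p ∈ basic a ∧ q ∈ basic aᶜ := fun p q b hp hq =>
    let ⟨a, ha, hab⟩ := p.exists_prec hp
    ⟨a, ha, (q.compl_mem_or hab).resolve_right hq⟩
  have hd : ∀ a : A, Disjoint (basic a) (basic aᶜ) := fun a => by
    rw [disjoint_basic_iff, compl_compl]
  refine ⟨fun p q hpq => ?_⟩
  have : ∃ b, ¬(b ∈ p.carrier ↔ b ∈ q.carrier) := by
    by_contra! h
    exact hpq (Point.ext (Set.ext h))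
  obtain ⟨b, hb⟩ := this
  by_cases hp : b ∈ p.carrier
  · obtain ⟨a, h1, h2⟩ := key p q b hp fun hq => hb ⟨fun _ => hq, fun _ => hp⟩
    exact ⟨_, _, isOpen_basic a, isOpen_basic aᶜ, h1, h2, hd a⟩
  · have hq : b ∈ q.carrier := by
      by_contra hq
      exact hb ⟨fun h => (hp h).elim, fun h => (hq h).elim⟩
    obtain ⟨a, h1, h2⟩ := key q p b hq hp
    exact ⟨_, _, isOpen_basic aᶜ, isOpen_basic a, h2, h1, (hd a).symm⟩

/-- An ultrafilter `𝒰` converges to the round part of the filter of all `a` with `basic a ∈ 𝒰`. The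
dichotomy holds because `basic aᶜ ∪ basic b` is the whole space when `a ≺ b`. -/
instance : CompactSpace (Point A) := by
  refine ⟨isCompact_iff_ultrafilter_le_nhds.2 fun 𝒰 _ => ?_⟩
  refine ⟨ofFilter {a | basic a ∈ 𝒰} ?_ ?_ ?_, Set.mem_univ _, ?_⟩
  · rw [Set.mem_ofPred_eq, basic_bot]
    exact 𝒰.empty_notMem
  · intro a b ha hb
    rw [Set.mem_ofPred_eq, basic_inf]
    exact Filter.inter_mem ha hb
  · intro a b hab
    refine Ultrafilter.union_mem_iff.1 (Filter.mem_of_superset Filter.univ_mem ?_)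
    exact fun p _ => p.compl_mem_or hab
  · intro s hs
    obtain ⟨_, ⟨b, rfl⟩, ⟨a, ha, hab⟩, hbs⟩ := isTopologicalBasis.mem_nhds_iff.1 hs
    exact Filter.mem_of_superset ha
      ((basic_subset_iff.2 (A.isProx.dv2 _ _ hab)).trans hbs)

/-- The interior of the complement of a union of basic open sets is a basic open set. -/
theorem interior_compl_eq {U : Set (Point A)} (hU : IsOpen U) :
    interior Uᶜ = basic (sSup {b : A | basic b ⊆ U})ᶜ := by
  ext p
  rw [mem_interior_iff_mem_nhds, isTopologicalBasis.mem_nhds_iff]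
  constructor
  · rintro ⟨_, ⟨c, rfl⟩, hp, hcU⟩
    refine basic_subset_iff.2 ?_ hp
    rw [le_compl_comm]
    exact sSup_le fun b hb => disjoint_basic_iff.1
      (Set.disjoint_left.2 fun q hq hqc => hcU hqc (hb hq))
  · intro hp
    refine ⟨_, ⟨_, rfl⟩, hp, fun q hq hqU => ?_⟩
    obtain ⟨_, ⟨b, rfl⟩, hqb, hbU⟩ := isTopologicalBasis.exists_subset_of_mem_open hqU hU
    exact q.compl_notMem (q.mem_of_le (le_sSup hbU) hqb) hq

theorem interior_compl_basic (a : A) : interior (basic a)ᶜ = basic aᶜ := by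
  rw [interior_compl_eq (isOpen_basic a)]
  have : {b : A | basic b ⊆ basic a} = Set.Iic a := Set.ext fun b => basic_subset_iff
  rw [this, csSup_Iic]

theorem closure_basic (a : A) : closure (basic a) = (basic aᶜ)ᶜ := by
  rw [← interior_compl_basic, interior_compl, compl_compl]

theorem interior_closure_basic (a : A) : interior (closure (basic a)) = basic a := by
  rw [closure_basic, interior_compl_basic, compl_compl]

theorem prec_iff {a b : A} : A.prec a b ↔ closure (basic a) ⊆ basic b := by
  constructor
  · intro h p hp
    rw [closure_basic] at hp
    exact (p.compl_mem_or h).resolve_left hp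
  · intro h
    -- By roundness the sets `basic c` with `c ≺ b` cover `basic b`. They are directed, so by
    -- compactness a single one contains `closure (basic a)`, and `a ≤ c ≺ b`.
    have : Nonempty {c // A.prec c b} :=
      ⟨⊥, prec_of_prec_of_le A.bot_prec_bot bot_le⟩
    obtain ⟨⟨c, hc⟩, hac⟩ := isClosed_closure.isCompact.elim_directed_cover
      (fun c : {c // A.prec c b} => basic c.1) (fun c => isOpen_basic _)
      (fun p hp => by
        obtain ⟨c, hpc, hcb⟩ := p.exists_prec (h hp)
        exact Set.mem_iUnion.2 ⟨⟨c, hcb⟩, hpc⟩)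
      (fun c d => ⟨⟨c.1 ⊔ d.1, prec_sup c.2 d.2⟩, basic_subset_iff.2 le_sup_left,
        basic_subset_iff.2 le_sup_right⟩)
    exact prec_of_le_of_prec (basic_subset_iff.1 (subset_closure.trans hac)) hc

/-- The elements of a de Vries algebra are the regular open sets of points. -/
def regularOpenIso (A : DeV.{u}) : A ≃o RegularOpen (Point A) where
  toFun a := ⟨⟨basic a, isOpen_basic a⟩,
    (RegularOpen.isRegular_iff _).2 (interior_closure_basic a)⟩
  invFun U := sSup {b : A | basic b ⊆ U.pts}
  left_inv a := by
    change sSup {b : A | basic b ⊆ basic a} = a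
    rw [show {b : A | basic b ⊆ basic a} = Set.Iic a from Set.ext fun b => basic_subset_iff,
      csSup_Iic]
  right_inv U := by
    refine Heyting.Regular.coe_injective (SetLike.coe_injective ?_)
    change basic (sSup {b : A | basic b ⊆ U.pts}) = U.pts
    rw [← compl_compl (sSup _), ← interior_compl_basic, ← interior_compl_eq U.isOpen_pts,
      ← closure_compl, compl_compl, U.interior_closure_pts]
  map_rel_iff' := basic_subset_iff

end Point

/-- A de Vries algebra is isomorphic to the regular open sets of its space of points. -/
def pointIso (A : DeV.{u}) : A ≅ deVriesDual.obj (op (CompHaus.of (Point A))) :=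
  isoOfOrderIso (B := (CompHaus.of (Point A)).regularOpens) (Point.regularOpenIso A) fun _ _ =>
    Point.prec_iff

end DeV

instance : deVriesDual.{u}.EssSurj where
  mem_essImage A := ⟨op (CompHaus.of (DeV.Point A)), ⟨A.pointIso.symm⟩⟩

/-! ## De Vries morphisms into powersets -/

namespace DeV

/-- The algebra of subsets of `X`, as a de Vries algebra. -/
abbrev powerset (X : Type u) : DeV.{u} := (tarskiDual.obj (op X)).toDeV

section

variable {A B : DeV.{u}} {X : Type u}

/-- The values of a de Vries morphism into a powerset, as sets. -/
def toSet (φ : A ⟶ powerset X) (a : A) : Set X := fn φ a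

theorem powerset_hom_ext {φ ψ : A ⟶ powerset X} (h : ∀ a, toSet φ a = toSet ψ a) : φ = ψ :=
  hom_ext h

theorem toSet_bot (φ : A ⟶ powerset X) : toSet φ ⊥ = ∅ := Hom.map_bot φ

theorem toSet_inf (φ : A ⟶ powerset X) (a b : A) : toSet φ (a ⊓ b) = toSet φ a ∩ toSet φ b :=
  Hom.map_inf φ a b

theorem toSet_mono (φ : A ⟶ powerset X) {a b : A} (h : a ≤ b) : toSet φ a ⊆ toSet φ b :=
  Hom.mono φ h

theorem mem_toSet_compl_or (φ : A ⟶ powerset X) {a b : A} (h : A.prec a b) (x : X) :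
    x ∈ toSet φ aᶜ ∨ x ∈ toSet φ b :=
  or_iff_not_imp_left.2 fun hx => (show (toSet φ aᶜ)ᶜ ⊆ toSet φ b from Hom.map_prec φ a b h) hx

theorem mem_toSet_iff (φ : A ⟶ powerset X) (b : A) (x : X) :
    x ∈ toSet φ b ↔ ∃ a, A.prec a b ∧ x ∈ toSet φ a := by
  have h : toSet φ b = ⋃₀ {y | ∃ a, A.prec a b ∧ y = toSet φ a} := Hom.map_approx φ b
  rw [h]
  constructor
  · rintro ⟨_, ⟨a, ha, rfl⟩, hx⟩
    exact ⟨a, ha, hx⟩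
  · rintro ⟨a, ha, hx⟩
    exact ⟨_, ⟨a, ha, rfl⟩, hx⟩

theorem mem_toSet_comp_iff (f : A ⟶ B) (φ : B ⟶ powerset X) (b : A) (x : X) :
    x ∈ toSet (f ≫ φ) b ↔ ∃ a, A.prec a b ∧ x ∈ toSet φ (fn f a) := by
  have h : toSet (f ≫ φ) b = ⋃₀ {y | ∃ a, A.prec a b ∧ y = toSet φ (fn f a)} := rfl
  rw [h]
  constructor
  · rintro ⟨_, ⟨a, ha, rfl⟩, hx⟩
    exact ⟨a, ha, hx⟩
  · rintro ⟨a, ha, hx⟩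
    exact ⟨_, ⟨a, ha, rfl⟩, hx⟩

/-- The point of `A` given by a point of `X` and a de Vries morphism from `A` to the powerset
of `X`. -/
def pointOf (φ : A ⟶ powerset X) (x : X) : Point A where
  carrier := {a | x ∈ toSet φ a}
  bot_notMem h := by
    have h : x ∈ toSet φ ⊥ := h
    rwa [toSet_bot] at h
  inf_mem {a b} ha hb := show x ∈ toSet φ (a ⊓ b) from (toSet_inf φ a b).ge ⟨ha, hb⟩
  mem_of_le h ha := toSet_mono φ h ha
  compl_mem_or h := mem_toSet_compl_or φ h x
  exists_prec {b} hb :=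
    let ⟨a, ha, hx⟩ := (mem_toSet_iff φ b x).1 hb
    ⟨a, hx, ha⟩

end

end DeV

/-! ### Regular open sets as a basis -/

namespace RegularOpen

variable {X Y : Type u} [TopologicalSpace Y] [CompactSpace Y] [T2Space Y]

theorem exists_regularOpen_subset {W : Set Y} (hW : IsOpen W) {y : Y}
    (hy : y ∈ W) : ∃ U : RegularOpen Y, y ∈ U.pts ∧ U.pts ⊆ W := by
  obtain ⟨F, hF, hFc, hFW⟩ := exists_mem_nhds_isClosed_subset (hW.mem_nhds hy)
  refine ⟨reg (interior F) isOpen_interior,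
    subset_reg _ _ (mem_interior_iff_mem_nhds.2 hF), ?_⟩
  rw [pts_reg]
  exact interior_subset.trans ((closure_minimal interior_subset hFc).trans hFW)

theorem eq_of_forall_regularOpen {y z : Y} (h : ∀ U : RegularOpen Y, y ∈ U.pts → z ∈ U.pts) :
    y = z := by
  by_contra hyz
  obtain ⟨U, hy, hU⟩ := exists_regularOpen_subset (isOpen_compl_singleton (x := z)) hyz
  exact hU (h U hy) rfl

theorem continuous_of_regularOpen [TopologicalSpace X] {f : X → Y}
    (h : ∀ U : RegularOpen Y, IsOpen (f ⁻¹' U.pts)) : Continuous f := by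
  refine ⟨fun W hW => isOpen_iff_mem_nhds.2 fun x hx => ?_⟩
  obtain ⟨U, hxU, hU⟩ := exists_regularOpen_subset hW (show f x ∈ W from hx)
  exact Filter.mem_of_superset ((h U).mem_nhds hxU) (Set.preimage_mono hU)

end RegularOpen

/-! ### Inverse image maps and the correspondence between functions and morphisms into powersets -/

namespace CompHaus

open DeV RegularOpen

variable {X : Type u} {Y Z : CompHaus.{u}}

/-- The inverse image map on regular open sets, as a de Vries morphism into the powerset. -/
def preim (f : X → Y) : deVriesDual.obj (op Y) ⟶ powerset X :=
  { toFun := fun U => f ⁻¹' U.pts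
    map_bot := rfl
    map_inf := fun _ _ => rfl
    map_prec := fun (U V : RegularOpen Y) h => by
      change (f ⁻¹' (Uᶜ).pts)ᶜ ⊆ f ⁻¹' V.pts
      have hU : (Uᶜ).pts = (closure U.pts)ᶜ := by rw [pts_compl, interior_compl]
      rw [hU, Set.preimage_compl, compl_compl]
      exact Set.preimage_mono h
    map_approx := fun V => by
      change f ⁻¹' V.pts = ⋃₀ {y | ∃ U, Prec U V ∧ y = f ⁻¹' U.pts}
      refine Set.Subset.antisymm (fun x hx => ?_) (Set.sUnion_subset ?_)
      · obtain ⟨U, hU, hUV⟩ := exists_prec V hx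
        exact ⟨_, ⟨U, hUV, rfl⟩, hU⟩
      · rintro _ ⟨U, hU, rfl⟩
        exact Set.preimage_mono (subset_closure.trans hU) }

theorem preim_injective {f g : X → Y} (h : preim f = preim g) : f = g := by
  refine funext fun x => eq_of_forall_regularOpen fun U hU => ?_
  have : x ∈ toSet (preim g) U := by
    rw [← h]
    exact hU
  exact this

/-- Points of the algebra of regular open sets of `Y` come from points of `Y`. -/
theorem exists_point_eq (p : Point (deVriesDual.obj (op Y))) :
    ∃ y : Y, ∀ U : RegularOpen Y, U ∈ p.carrier ↔ y ∈ U.pts := by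
  -- By compactness the closures of the members of `p` have a common point; roundness then puts it
  -- in the members themselves.
  have hne : (⋂ U : p.carrier, closure (pts (X := Y) U.1)).Nonempty := by
    refine IsCompact.nonempty_iInter_of_directed_nonempty_isCompact_isClosed
      (hι := ⟨⟨⊤, p.top_mem⟩⟩) _ (fun U V => ?_) (fun U => ?_)
      (fun U => isClosed_closure.isCompact) (fun U => isClosed_closure)
    · exact ⟨⟨_, p.inf_mem U.2 V.2⟩, closure_mono Set.inter_subset_left,
        closure_mono Set.inter_subset_right⟩
    · refine Set.Nonempty.closure (Set.nonempty_iff_ne_empty.2 fun h => ?_)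
      have hU : U.1 = ⊥ := le_bot_iff.1 (pts_le.2 h.le)
      exact p.bot_notMem (hU ▸ U.2)
  obtain ⟨y, hy⟩ := hne
  rw [Set.mem_iInter] at hy
  have h1 : ∀ U : RegularOpen Y, U ∈ p.carrier → y ∈ U.pts := fun U hU =>
    let ⟨V, hV, hVU⟩ := p.exists_prec hU
    hVU (hy ⟨V, hV⟩)
  refine ⟨y, fun U => ⟨h1 U, fun hU => ?_⟩⟩
  obtain ⟨V, hyV, hVU⟩ := exists_prec U hU
  refine (p.compl_mem_or hVU).resolve_left fun h => ?_
  have h2 : y ∈ (Vᶜ).pts := h1 _ h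
  rw [pts_compl] at h2
  exact interior_subset h2 hyV

theorem exists_eq_preim (φ : deVriesDual.obj (op Y) ⟶ powerset X) : ∃ f : X → Y, φ = preim f := by
  choose f hf using fun x => exists_point_eq (pointOf φ x)
  exact ⟨f, powerset_hom_ext fun U => Set.ext fun x => hf x U⟩

/-- The regularization in `g^*` is absorbed by `⋆`: for `U ≺ V` one has `g⁻¹ U ⊆ g^*(U) ⊆ g⁻¹ V`,
and the sets `U ≺ V` cover `V`. -/
theorem map_comp_preim (g : Y ⟶ Z) (f : X → Y) :
    deVriesDual.map g.op ≫ preim f = preim (fun x => g (f x)) := by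
  refine powerset_hom_ext fun (V : RegularOpen Z) => Set.ext fun x => ?_
  refine (mem_toSet_comp_iff _ _ _ _).trans ⟨?_, ?_⟩
  · rintro ⟨U, hUV, hx⟩
    exact pts_pullback_subset g g.hom.hom.continuous hUV hx
  · intro hx
    obtain ⟨U, hxU, hUV⟩ := exists_prec V (show g (f x) ∈ V.pts from hx)
    exact ⟨U, hUV, subset_reg (g ⁻¹' U.pts) (U.isOpen_pts.preimage g.hom.hom.continuous) hxU⟩

/-- A nonempty open set missed by `f` contains a nonempty regular open set with the same inverse
image as `⊥`. Conversely, a regular open set is recovered from its trace on a dense set as the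
interior of the closure. -/
theorem injective_preim_iff (f : X → Y) :
    Function.Injective (fn (preim f)) ↔ DenseRange f := by
  constructor
  · intro h
    refine dense_iff_inter_open.2 fun W hW ⟨y, hy⟩ => ?_
    obtain ⟨U, hyU, hUW⟩ := exists_regularOpen_subset hW hy
    by_contra hn
    have hU : (U : deVriesDual.obj (op Y)) = (⊥ : RegularOpen Y) :=
      h (Set.eq_empty_of_forall_notMem fun x hx => hn ⟨f x, hUW hx, x, rfl⟩)
    rw [hU] at hyU
    exact hyU
  · intro hf
    have key : ∀ U V : RegularOpen Y, f ⁻¹' U.pts = f ⁻¹' V.pts → U ≤ V := fun U V h => by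
      rw [pts_le, ← U.interior_closure_pts, ← V.interior_closure_pts]
      refine interior_mono (closure_minimal ((hf.open_subset_closure_inter U.isOpen_pts).trans
        (closure_mono ?_)) isClosed_closure)
      rintro _ ⟨hU, x, rfl⟩
      exact h.le hU
    exact fun U V h => le_antisymm (key U V h) (key V U h.symm)

/-- Meets of inverse images cannot separate points with the same image. If `f` is injective, `{x}`
is the meet of all `f⁻¹ U` with `f x ∈ U`, and singletons generate under joins. -/
theorem joinMeetDense_preim_iff (f : X → Y) :
    JoinMeetDense (preim f) ↔ Function.Injective f := by
  constructor
  · intro h x x' hxx'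
    obtain ⟨S, hS, hx⟩ := h (show Set X from {x})
    have hx : ({x} : Set X) = ⋃₀ S := hx
    obtain ⟨s, hs, hxs⟩ := hx.le rfl
    obtain ⟨M, hM, hsM⟩ := hS s hs
    have hsM : s = ⋂₀ M := hsM
    have hx's : x' ∈ s := by
      rw [hsM] at hxs ⊢
      intro m hm
      obtain ⟨U, rfl⟩ := hM hm
      have : f x ∈ pts (X := Y) U := hxs _ hm
      rw [hxx'] at this
      exact this
    exact (hx.ge ⟨s, hs, hx's⟩ : x' = x).symm
  · intro hf b
    refine ⟨{s | ∃ x ∈ (show Set X from b), s = (show Set X from {x})}, ?_, ?_⟩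
    · rintro _ ⟨x, -, rfl⟩
      refine ⟨{m | ∃ U : RegularOpen Y, f x ∈ U.pts ∧ m = fn (preim f) U}, ?_, ?_⟩
      · rintro _ ⟨U, -, rfl⟩
        exact ⟨U, rfl⟩
      · change ({x} : Set X) = ⋂₀ {m | ∃ U : RegularOpen Y, f x ∈ U.pts ∧ m = f ⁻¹' U.pts}
        refine Set.Subset.antisymm ?_ fun z hz => ?_
        · rintro _ rfl _ ⟨U, hU, rfl⟩
          exact hU
        · exact (hf (eq_of_forall_regularOpen fun U hU => hz _ ⟨U, hU, rfl⟩)).symm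
    · change (show Set X from b) = ⋃₀ {s | ∃ x ∈ (show Set X from b), s = {x}}
      ext x
      constructor
      · exact fun hx => ⟨_, ⟨x, hx, rfl⟩, rfl⟩
      · rintro ⟨_, ⟨z, hz, rfl⟩, hx⟩
        rwa [show x = z from hx]

theorem isDeVriesExtension_preim_iff (f : X → Y) :
    IsDeVriesExtension (B := tarskiDual.obj (op X)) (preim f) ↔
      DenseRange f ∧ Function.Injective f :=
  ⟨fun h => ⟨(injective_preim_iff f).1 h.injective, (joinMeetDense_preim_iff f).1 h.dense⟩,
    fun h => ⟨(injective_preim_iff f).2 h.1, (joinMeetDense_preim_iff f).2 h.2⟩⟩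

instance mono_preim_id (Y : CompHaus.{u}) : Mono (preim fun y : Y => y) :=
  mono_of_injective ((injective_preim_iff _).2 Function.surjective_id.denseRange)

end CompHaus

/-! ### Full faithfulness in de Vries duality -/

instance : deVriesDual.{u}.Faithful where
  map_injective {Y Z} f g h := by
    have h' : CompHaus.preim (fun z : Z.unop => f.unop z) = CompHaus.preim fun z => g.unop z := by
      rw [← CompHaus.map_comp_preim f.unop (fun z => z), ← CompHaus.map_comp_preim g.unop]
      exact congrArg (· ≫ _) h
    exact Quiver.Hom.unop_inj (ConcreteCategory.hom_ext _ _ (congrFun (CompHaus.preim_injective h')))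

instance : deVriesDual.{u}.Full where
  map_surjective {Y Z} ρ := by
    -- Forgetting the topology of the target space turns `ρ` into an inverse image map. Its value at
    -- `V` is the union of the open sets `ρ U` with `U ≺ V`, so `f` is continuous.
    obtain ⟨f, hf⟩ := CompHaus.exists_eq_preim (ρ ≫ CompHaus.preim fun z : Z.unop => z)
    have hc : Continuous f := by
      refine RegularOpen.continuous_of_regularOpen fun V => isOpen_iff_mem_nhds.2 fun z hz => ?_
      have hz : z ∈ DeV.toSet (CompHaus.preim f) V := hz
      rw [← hf] at hz
      obtain ⟨U, hUV, hz⟩ := (DeV.mem_toSet_comp_iff _ _ _ _).1 hz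
      refine Filter.mem_of_superset ((RegularOpen.isOpen_pts (DeV.fn ρ U)).mem_nhds hz)
        fun w hw => ?_
      change w ∈ DeV.toSet (CompHaus.preim f) V
      rw [← hf]
      exact (DeV.mem_toSet_comp_iff _ _ _ _).2 ⟨U, hUV, hw⟩
    let g : Z.unop ⟶ Y.unop := CompHausLike.ofHom _ ⟨f, hc⟩
    refine ⟨g.op, ?_⟩
    rw [← cancel_mono (CompHaus.preim fun z : Z.unop => z), hf]
    exact CompHaus.map_comp_preim g _

instance : deVriesDual.{u}.IsEquivalence where

/-! ## Tarski duality -/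

instance : tarskiDual.{u}.Faithful where
  map_injective {Y Z} f g h := by
    refine Quiver.Hom.unop_inj (ConcreteCategory.hom_ext _ _ fun z => ?_)
    have h' := congrArg (fun σ => (show Set Z.unop from CABA.fn σ (show Set Y.unop from {g.unop z}))) h
    exact h'.ge (show g.unop z = g.unop z from rfl)

/-- A complete homomorphism between powersets is an inverse image map. -/
theorem CompleteLatticeHom.exists_eq_setPreimage {X Y : Type u}
    (σ : CompleteLatticeHom (Set Y) (Set X)) : ∃ f : X → Y, ∀ S, σ S = f ⁻¹' S := by
  -- The top element is the join of the singletons and `σ` preserves it, so every `x` lies in the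
  -- image of some singleton.
  have h : ∀ x : X, ∃ y : Y, x ∈ σ {y} := fun x => by
    have h1 : σ (⋃₀ Set.range fun y : Y => {y}) = ⋃₀ (σ '' Set.range fun y : Y => {y}) :=
      map_sSup σ _
    have h2 : (⋃₀ Set.range fun y : Y => ({y} : Set Y)) = ⊤ :=
      Set.eq_univ_of_forall fun y => ⟨{y}, ⟨y, rfl⟩, rfl⟩
    rw [h2, map_top] at h1
    obtain ⟨_, ⟨_, ⟨y, rfl⟩, rfl⟩, hx⟩ := h1.le (Set.mem_univ x)
    exact ⟨y, hx⟩
  choose f hf using h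
  refine ⟨f, fun S => Set.ext fun x => ⟨fun hx => ?_, fun hx => ?_⟩⟩
  · by_contra hn
    have h1 : x ∈ σ (S ⊓ {f x}) := by
      rw [map_inf]
      exact ⟨hx, hf x⟩
    have h2 : S ⊓ {f x} = ⊥ := Set.inter_singleton_eq_empty.2 hn
    rw [h2, map_bot] at h1
    exact h1
  · have hS : ({f x} : Set Y) ⊆ S := Set.singleton_subset_iff.2 hx
    exact (OrderHomClass.mono σ hS : σ {f x} ⊆ σ S) (hf x)

instance : tarskiDual.{u}.Full where
  map_surjective {Y Z} σ := by
    obtain ⟨f, hf⟩ := CompleteLatticeHom.exists_eq_setPreimage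
      (show CompleteLatticeHom (Set Y.unop) (Set Z.unop) from σ)
    exact ⟨(TypeCat.ofHom f).op, CompleteLatticeHom.ext fun S => (hf S).symm⟩

namespace CABA

variable {B C D : CABA.{u}}

theorem hom_ext {σ τ : B ⟶ C} (h : ∀ b, fn σ b = fn τ b) : σ = τ :=
  CompleteLatticeHom.ext h

/-- An order isomorphism, as a complete Boolean homomorphism. -/
def homOfOrderIso (e : B ≃o C) : B ⟶ C :=
  show CompleteLatticeHom B C from
  { toFun := e
    map_sInf' := fun S => by rw [e.map_sInf, sInf_image]
    map_sSup' := fun S => by rw [e.map_sSup, sSup_image] }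

/-- Order isomorphic complete atomic Boolean algebras are isomorphic. -/
def isoOfOrderIso (e : B ≃o C) : B ≅ C where
  hom := homOfOrderIso e
  inv := homOfOrderIso e.symm
  hom_inv_id := hom_ext e.symm_apply_apply
  inv_hom_id := hom_ext e.apply_symm_apply

/-- An element of a complete atomic Boolean algebra is determined by the atoms below it. -/
def atomsIso (B : CABA.{u}) : B ≃o Set {a : B // IsAtom a} where
  toFun b := {a | a.1 ≤ b}
  invFun T := sSup (Subtype.val '' T)
  left_inv b := by
    refine le_antisymm (sSup_le ?_) (BooleanAlgebra.le_iff_atom_le_imp.2 fun a ha hab =>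
      le_sSup ⟨⟨a, ha⟩, hab, rfl⟩)
    rintro _ ⟨a, ha, rfl⟩
    exact ha
  right_inv T := by
    ext ⟨a, ha⟩
    refine ha.le_sSup.trans ⟨?_, fun h => ⟨a, ⟨⟨a, ha⟩, h, rfl⟩, le_rfl⟩⟩
    rintro ⟨_, ⟨b, hb, rfl⟩, hab⟩
    have : (⟨a, ha⟩ : {a : B // IsAtom a}) = b :=
      Subtype.ext ((b.2.le_iff.1 hab).resolve_left ha.1)
    rwa [this]
  map_rel_iff' := ⟨fun h => BooleanAlgebra.le_iff_atom_le_imp.2 fun a ha => @h ⟨a, ha⟩,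
    fun h _ ha => le_trans ha h⟩

/-- A complete atomic Boolean algebra is isomorphic to the powerset of its set of atoms. -/
def atomsPowersetIso (B : CABA.{u}) : B ≅ tarskiDual.obj (op {a : B // IsAtom a}) :=
  isoOfOrderIso (C := tarskiDual.obj (op {a : B // IsAtom a})) B.atomsIso

theorem inv_apply_hom_apply (e : B ≅ C) (b : B) : fn e.inv (fn e.hom b) = b :=
  congrArg (fun σ => fn σ b) e.hom_inv_id

theorem map_sSup_fn (σ : B ⟶ C) (S : Set B) : fn σ (sSup S) = sSup (fn σ '' S) :=
  map_sSup (show CompleteLatticeHom B C from σ) S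

theorem map_sInf_fn (σ : B ⟶ C) (S : Set B) : fn σ (sInf S) = sInf (fn σ '' S) :=
  map_sInf (show CompleteLatticeHom B C from σ) S

/-- A complete Boolean homomorphism, as a morphism of `DeV`. -/
abbrev toDeVHom (σ : B ⟶ C) : B.toDeV ⟶ C.toDeV := homToDeV σ

theorem toDeVHom_comp (σ : B ⟶ C) (τ : C ⟶ D) :
    toDeVHom (σ ≫ τ) = toDeVHom σ ≫ toDeVHom τ :=
  (toMDeVe ⋙ MDeVe.baseFunctor).map_comp σ τ

theorem toDeVHom_id (B : CABA.{u}) : toDeVHom (𝟙 B) = 𝟙 B.toDeV := rfl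

/-- `σ` preserves the join that approximates `α a`, so here `⋆` is pointwise composition. -/
theorem comp_toDeVHom_apply {A : DeV.{u}} (α : A ⟶ B.toDeV) (σ : B ⟶ C) (a : A) :
    DeV.fn (α ≫ toDeVHom σ) a = fn σ (DeV.fn α a) := by
  refine le_antisymm (DeV.comp_apply_le _ _ a) ?_
  have h : DeV.fn α a = sSup {y | ∃ b, A.prec b a ∧ y = DeV.fn α b} := DeV.Hom.map_approx α a
  rw [h]
  refine (map_sSup_fn σ _).le.trans (sSup_le ?_)
  rintro _ ⟨_, ⟨b, hb, rfl⟩, rfl⟩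
  exact DeV.apply_le_comp α (toDeVHom σ) hb

end CABA

instance : tarskiDual.{u}.EssSurj where
  mem_essImage B := ⟨op {a : B // IsAtom a}, ⟨B.atomsPowersetIso.symm⟩⟩

instance : tarskiDual.{u}.IsEquivalence where

instance : CABA.toMDeVe.{u}.Faithful where
  map_injective h := congrArg (fun f => DeVe.Hom.σ f.hom) h

instance : CABA.toMDeVe.{u}.Full where
  map_surjective {B C} f := by
    refine ⟨DeVe.Hom.σ f.hom, ObjectProperty.hom_ext _ (DeVe.Hom.ext (DeV.hom_ext fun b => ?_) rfl)⟩
    refine (DeVe.Hom.comm f.hom b).trans ?_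
    exact congrArg (fun h => DeV.fn h b) (Category.comp_id (DeVe.Hom.ρ f.hom))

/-! ## Changing the ends of a de Vries extension -/

namespace IsDeVriesExtension

variable {A A' : DeV.{u}} {B B' : CABA.{u}}

theorem mono {α : A ⟶ B.toDeV} (h : IsDeVriesExtension α) : Mono α :=
  DeV.mono_of_injective h.injective

theorem iso_comp {α : A ⟶ B.toDeV} (h : IsDeVriesExtension α) (e : A' ≅ A) :
    IsDeVriesExtension (e.hom ≫ α) where
  injective a b hab := by
    rw [DeV.hom_comp_apply, DeV.hom_comp_apply] at hab
    exact DeV.hom_injective e (h.injective hab)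
  dense := by
    unfold JoinMeetDense
    rw [DeV.range_hom_comp]
    exact h.dense

theorem comp_iso {α : A ⟶ B.toDeV} (h : IsDeVriesExtension α) (e : B ≅ B') :
    IsDeVriesExtension (α ≫ CABA.toDeVHom e.hom) where
  injective a b hab := by
    rw [CABA.comp_toDeVHom_apply, CABA.comp_toDeVHom_apply] at hab
    have hinj : Function.Injective (CABA.fn e.hom) :=
      Function.LeftInverse.injective (CABA.inv_apply_hom_apply e)
    exact h.injective (hinj hab)
  dense b := by
    obtain ⟨S, hS, hb⟩ := h.dense (CABA.fn e.inv b)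
    refine ⟨CABA.fn e.hom '' S, ?_, ?_⟩
    · rintro _ ⟨s, hs, rfl⟩
      obtain ⟨M, hM, rfl⟩ := hS s hs
      refine ⟨CABA.fn e.hom '' M, ?_, CABA.map_sInf_fn e.hom M⟩
      rintro _ ⟨m, hm, rfl⟩
      obtain ⟨a, rfl⟩ := hM hm
      exact ⟨a, CABA.comp_toDeVHom_apply _ _ _⟩
    · refine Eq.trans ?_ (CABA.map_sSup_fn e.hom S)
      exact (CABA.inv_apply_hom_apply e.symm b).symm.trans (congrArg (CABA.fn e.hom) hb)

end IsDeVriesExtension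

/-- Maximal de Vries extensions are isomorphic if their images correspond under an isomorphism of
their codomains. -/
theorem MDeVe.nonempty_iso {E E' : MDeVe.{u}} (e : E.obj.top ≅ E'.obj.top)
    (h : Set.range (DeV.fn (E.obj.map ≫ CABA.toDeVHom e.hom)) = Set.range (DeV.fn E'.obj.map)) :
    Nonempty (E ≅ E') := by
  -- Maximality of each side, tested against the other extension transported along `e`, gives de
  -- Vries morphisms both ways. They are mutually inverse because extensions are monomorphisms.
  obtain ⟨δ, hδ⟩ := E'.property _ _ (E.obj.isExt.comp_iso e) h.symm
  obtain ⟨ε, hε⟩ := E.property _ _ (E'.obj.isExt.comp_iso e.symm) <| by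
    have h1 : DeV.fn (E'.obj.map ≫ CABA.toDeVHom e.inv) = CABA.fn e.inv ∘ E'.obj.fn :=
      funext (CABA.comp_toDeVHom_apply _ _)
    have h2 : DeV.fn (E.obj.map ≫ CABA.toDeVHom e.hom) = CABA.fn e.hom ∘ E.obj.fn :=
      funext (CABA.comp_toDeVHom_apply _ _)
    have h3 : Set.range (CABA.fn e.hom ∘ E.obj.fn) = Set.range E'.obj.fn :=
      (congrArg Set.range h2).symm.trans h
    have h4 : (CABA.fn e.inv ∘ CABA.fn e.hom) ∘ E.obj.fn = E.obj.fn :=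
      funext fun a => CABA.inv_apply_hom_apply e _
    have h5 : Set.range E.obj.fn = Set.range (CABA.fn e.inv ∘ E'.obj.fn) := by
      rw [Set.range_comp, ← h3, ← Set.range_comp, ← Function.comp_assoc, h4]
    exact h5.trans (congrArg Set.range h1).symm
  rw [Iso.symm_hom] at hε
  have := E.obj.isExt.mono
  have := E'.obj.isExt.mono
  refine ⟨ObjectProperty.isoMk _
    { hom := { ρ := δ, σ := e.hom, comm := fun a => ?_ }
      inv := { ρ := ε, σ := e.inv, comm := fun a => ?_ }
      hom_inv_id := DeVe.Hom.ext ?_ e.hom_inv_id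
      inv_hom_id := DeVe.Hom.ext ?_ e.inv_hom_id }⟩
  · rw [hδ, CABA.comp_toDeVHom_apply]
  · rw [hε, CABA.comp_toDeVHom_apply]
  · change δ ≫ ε = 𝟙 _
    rw [← cancel_mono E.obj.map, Category.assoc, hε, ← Category.assoc, hδ, Category.assoc,
      ← CABA.toDeVHom_comp, e.hom_inv_id, CABA.toDeVHom_id, Category.comp_id, Category.id_comp]
  · change ε ≫ δ = 𝟙 _
    rw [← cancel_mono E'.obj.map, Category.assoc, hδ, ← Category.assoc, hε, Category.assoc,
      ← CABA.toDeVHom_comp, e.inv_hom_id, CABA.toDeVHom_id, Category.comp_id, Category.id_comp]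

/-! ## Regular open sets of dense subspaces -/

/-- The regular open sets of a dense subspace are the traces of regular open sets. -/
theorem IsDenseInducing.exists_regularOpen_preimage_eq_iff {X Y : Type u} [TopologicalSpace X]
    [TopologicalSpace Y] {f : X → Y} (hf : IsDenseInducing f) (V : Set X) :
    (∃ U : RegularOpen Y, f ⁻¹' U.pts = V) ↔ interior (closure V) = V := by
  -- Density gives `closure (U ∩ range f) = closure U` for open `U`, so closure commutes with
  -- inverse image on open sets.
  have hcl : ∀ U : Set Y, IsOpen U → closure (f ⁻¹' U) = f ⁻¹' closure U := fun U hU => by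
    rw [hf.isInducing.closure_eq_preimage_closure_image, Set.image_preimage_eq_inter_range,
      Set.Subset.antisymm (closure_mono Set.inter_subset_left)
        (closure_minimal (hf.dense.open_subset_closure_inter hU) isClosed_closure)]
  constructor
  · rintro ⟨U, rfl⟩
    refine subset_antisymm ?_ (interior_maximal subset_closure
      (U.isOpen_pts.preimage hf.continuous))
    rw [hcl _ U.isOpen_pts]
    -- The interior is the trace of an open `W`. By density `W ⊆ closure U`, hence `W` lies in the
    -- regular open set `U`.
    obtain ⟨W, hW, hWU⟩ := hf.isInducing.isOpen_iff.1
      (isOpen_interior (s := f ⁻¹' closure U.pts))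
    rw [← hWU]
    refine Set.preimage_mono ?_
    rw [← U.interior_closure_pts]
    refine interior_maximal ((hf.dense.open_subset_closure_inter hW).trans
      (closure_minimal ?_ isClosed_closure)) hW
    rintro _ ⟨hx, x, rfl⟩
    have hx : x ∈ interior (f ⁻¹' closure U.pts) := hWU.le hx
    exact (interior_subset hx : x ∈ f ⁻¹' closure U.pts)
  · intro hV
    obtain ⟨W, hW, rfl⟩ := hf.isInducing.isOpen_iff.1 (hV ▸ isOpen_interior : IsOpen V)
    refine ⟨RegularOpen.reg W hW, subset_antisymm ?_ (Set.preimage_mono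
      (RegularOpen.subset_reg W hW))⟩
    rw [← hV]
    refine interior_maximal ?_ ((RegularOpen.isOpen_pts _).preimage hf.continuous)
    rw [hcl W hW, RegularOpen.pts_reg]
    exact Set.preimage_mono interior_subset

/-! ## The maximal de Vries extension of a completely regular space -/

namespace CReg

open DeV CompHaus

theorem isDenseEmbedding_s (X : CReg.{u}) : IsDenseEmbedding X.s :=
  have := X.property
  isDenseEmbedding_stoneCechUnit

/-- The extension of a continuous map to the Stone–Čech compactification. -/
theorem exists_extend (X : CReg.{u}) {Y : CompHaus.{u}} {f : X.obj → Y} (hf : Continuous f) :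
    ∃ g : beta.obj X ⟶ Y, ∀ x, g (X.s x) = f x :=
  ⟨CompHausLike.ofHom _ ⟨stoneCechExtend hf, continuous_stoneCechExtend hf⟩,
    stoneCechExtend_stoneCechUnit hf⟩

theorem beta_map_s {X Y : CReg.{u}} (f : X ⟶ Y) (x : X.obj) :
    beta.map f (X.s x) = Y.s (f.hom x) :=
  stoneCechExtend_stoneCechUnit (continuous_stoneCechUnit.comp f.hom.hom.continuous) x

theorem isDeVriesExtension_preim_s (X : CReg.{u}) :
    IsDeVriesExtension (B := tarskiDual.obj (op (points.obj X))) (preim X.s) :=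
  (isDeVriesExtension_preim_iff X.s).2 ⟨X.isDenseEmbedding_s.dense, X.isDenseEmbedding_s.injective⟩

/-- A de Vries morphism into the powerset of `X` with open values factors through the regular open
sets of the Stone–Čech compactification. -/
theorem exists_comp_preim_s_eq (X : CReg.{u}) {C : DeV.{u}} (γ : C ⟶ powerset X.obj)
    (hγ : ∀ c, IsOpen (toSet γ c)) :
    ∃ δ : C ⟶ deVriesDual.obj (op (beta.obj X)), δ ≫ preim X.s = γ := by
  -- Over the space of points of `C`, `γ` is inverse image along `t`. Open values make `t`
  -- continuous, so it extends to `βX`, and the dual of the extension gives `δ`.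
  obtain ⟨t, ht⟩ := exists_eq_preim (C.pointIso.inv ≫ γ)
  have hc : Continuous t := by
    refine RegularOpen.continuous_of_regularOpen fun U => ?_
    have h : t ⁻¹' U.pts = toSet γ (fn C.pointIso.inv U) :=
      (show fn (preim t) U = fn (C.pointIso.inv ≫ γ) U by rw [← ht]).trans (hom_comp_apply C.pointIso.symm γ U)
    rw [h]
    exact hγ _
  obtain ⟨g, hg⟩ := X.exists_extend hc
  refine ⟨C.pointIso.hom ≫ deVriesDual.map g.op, ?_⟩
  rw [Category.assoc, map_comp_preim, funext hg, ← ht, Iso.hom_inv_id_assoc]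

theorem isOpen_toSet_comp_preim_s (X : CReg.{u}) {C : DeV.{u}}
    (ρ : C ⟶ deVriesDual.obj (op (beta.obj X))) (c : C) : IsOpen (toSet (ρ ≫ preim X.s) c) := by
  refine isOpen_iff_mem_nhds.2 fun x hx => ?_
  obtain ⟨b, hb, hxb⟩ := (mem_toSet_comp_iff _ _ _ _).1 hx
  have ho : IsOpen (toSet (preim X.s) (fn ρ b)) :=
    (RegularOpen.isOpen_pts (X := beta.obj X) (fn ρ b)).preimage X.isDenseEmbedding_s.continuous
  exact Filter.mem_of_superset (ho.mem_nhds hxb) fun y hy =>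
    (mem_toSet_comp_iff _ _ _ _).2 ⟨b, hb, hy⟩

/-- The maximal de Vries extension `s⁻¹ : RO(βX) → ℘(X)`. -/
noncomputable def extension (X : CReg.{u}) : MDeVe.{u} where
  obj :=
    { base := deVriesDual.obj (op (beta.obj X))
      top := tarskiDual.obj (op (points.obj X))
      map := preim X.s
      isExt := X.isDeVriesExtension_preim_s }
  -- A compatible `γ` takes the same values as `s⁻¹`, which are open, so the universal property of
  -- `βX` applies.
  property := fun _ γ _ hr => X.exists_comp_preim_s_eq γ fun c => by
    obtain ⟨U, hU⟩ := hr.ge ⟨c, rfl⟩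
    have h : X.s ⁻¹' RegularOpen.pts (X := beta.obj X) U = toSet (X := X.obj) γ c := hU
    exact (congrArg IsOpen h).mp
      ((RegularOpen.isOpen_pts _).preimage X.isDenseEmbedding_s.continuous)

/-- The morphism of maximal de Vries extensions given by a continuous map. -/
noncomputable def extensionMap {X Y : CReg.{u}} (f : X ⟶ Y) : Y.extension ⟶ X.extension :=
  ObjectProperty.homMk
    { ρ := deVriesDual.map (beta.map f).op
      σ := tarskiDual.map (points.map f).op
      comm := fun a => by
        refine Eq.trans ?_ (congrArg (fun φ => fn φ a) (map_comp_preim (beta.map f) X.s)).symm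
        rw [funext (beta_map_s f)]
        rfl }

/-- The contravariant functor from completely regular spaces to maximal de Vries extensions. -/
noncomputable def toMDeVe : CReg.{u}ᵒᵖ ⥤ MDeVe.{u} where
  obj X := X.unop.extension
  map f := extensionMap f.unop
  map_id X := ObjectProperty.hom_ext _ (DeVe.Hom.ext
    ((beta.op ⋙ deVriesDual).map_id X) ((points.op ⋙ tarskiDual).map_id X))
  map_comp f g := ObjectProperty.hom_ext _ (DeVe.Hom.ext
    ((beta.op ⋙ deVriesDual).map_comp f g) ((points.op ⋙ tarskiDual).map_comp f g))

instance : toMDeVe.{u}.Faithful where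
  map_injective {X Y} f g h := by
    have h' : (points.map f.unop).op = (points.map g.unop).op :=
      tarskiDual.map_injective (congrArg (fun k => DeVe.Hom.σ k.hom) h)
    refine Quiver.Hom.unop_inj (ObjectProperty.hom_ext _ (ConcreteCategory.hom_ext _ _ fun y => ?_))
    exact congrArg (fun k : points.obj Y.unop ⟶ points.obj X.unop => k y)
      (Quiver.Hom.op_inj h')

/-- Tarski duality provides the function. Continuity comes from compatibility, since `s⁻¹ ⋆ ρ` has
open values, and cancelling the monomorphism `s⁻¹` identifies `ρ`. -/
instance : toMDeVe.{u}.Full where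
  map_surjective {Y X} k := by
    let ρ : deVriesDual.obj (op (beta.obj Y.unop)) ⟶ deVriesDual.obj (op (beta.obj X.unop)) :=
      DeVe.Hom.ρ k.hom
    obtain ⟨f, hf⟩ := tarskiDual.map_surjective (X := op (points.obj Y.unop))
      (Y := op (points.obj X.unop)) (DeVe.Hom.σ k.hom)
    let f' : X.unop.obj → Y.unop.obj := fun x => f.unop x
    have hρ : ρ ≫ preim X.unop.s = preim fun x => Y.unop.s (f' x) :=
      powerset_hom_ext fun U => (DeVe.Hom.comm k.hom U).symm.trans
        (congrArg (fun σ => CABA.fn σ (fn (preim Y.unop.s) U)) hf.symm)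
    have hc : Continuous f' := by
      refine Y.unop.isDenseEmbedding_s.isInducing.continuous_iff.2 ?_
      refine RegularOpen.continuous_of_regularOpen fun U => ?_
      have h := X.unop.isOpen_toSet_comp_preim_s ρ U
      rw [hρ] at h
      exact h
    let g : X.unop ⟶ Y.unop := ObjectProperty.homMk (TopCat.ofHom ⟨f', hc⟩)
    refine ⟨g.op, ObjectProperty.hom_ext _ (DeVe.Hom.ext ?_ hf)⟩
    have : Mono (preim X.unop.s) := X.unop.isDeVriesExtension_preim_s.mono
    refine (cancel_mono (preim X.unop.s)).1 (Eq.trans ?_ hρ.symm)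
    refine (map_comp_preim (beta.map g) X.unop.s).trans (congrArg _ (funext (beta_map_s g)))

instance : toMDeVe.{u}.EssSurj where
  mem_essImage E := by
    let T := {a : E.obj.top // IsAtom a}
    let Y := CompHaus.of (Point E.obj.base)
    let e : E.obj.top ≅ tarskiDual.obj (op T) := E.obj.top.atomsPowersetIso
    let i : E.obj.base ≅ deVriesDual.obj (op Y) := E.obj.base.pointIso
    obtain ⟨s, hs⟩ := exists_eq_preim (i.inv ≫ E.obj.map ≫ CABA.toDeVHom e.hom)
    have hext := (E.obj.isExt.comp_iso e).iso_comp i.symm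
    rw [show i.symm.hom ≫ E.obj.map ≫ CABA.toDeVHom e.hom = preim s from hs] at hext
    obtain ⟨hd, hinj⟩ := (isDeVriesExtension_preim_iff s).1 hext
    -- The atoms inherit their topology from the space of points of the base, which makes them
    -- completely regular with `s` a compactification.
    let : TopologicalSpace T := .induced s inferInstance
    have hemb : Topology.IsEmbedding s := ⟨⟨rfl⟩, hinj⟩
    have : T35Space T := hemb.t35Space
    let X : CReg.{u} := ⟨TopCat.of T, this⟩
    -- Both images are the family of regular open sets of `X`, computed in two compactifications.
    have hr : Set.range (fn (E.obj.map ≫ CABA.toDeVHom e.hom)) =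
        Set.range (fn (preim (X := T) X.s)) := by
      rw [← range_hom_comp i.symm, Iso.symm_hom, hs]
      ext V
      exact (IsDenseInducing.exists_regularOpen_preimage_eq_iff ⟨⟨rfl⟩, hd⟩ V).trans
        (X.isDenseEmbedding_s.isDenseInducing.exists_regularOpen_preimage_eq_iff V).symm
    obtain ⟨k⟩ := MDeVe.nonempty_iso (E := E) (E' := X.extension) e hr
    exact ⟨op X, ⟨k.symm⟩⟩

instance : toMDeVe.{u}.IsEquivalence where

end CReg

/-! ## Restriction to compact and to discrete spaces -/

namespace CReg

open DeV CompHaus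

/-- The Stone–Čech compactification of a compact Hausdorff space is the space itself. -/
noncomputable def ofCompHausBeta : ofCompHaus.{u} ⋙ beta ≅ 𝟭 CompHaus.{u} :=
  show compHausToTop.{u} ⋙ reflector compHausToTop.{u} ≅ 𝟭 CompHaus.{u} from
    asIso (reflectorAdjunction compHausToTop.{u}).counit

instance : ofCompHaus.{u}.Faithful where
  map_injective h := compHausToTop.map_injective (congrArg (fun k => k.hom) h)

instance : ofCompHaus.{u}.Full where
  map_surjective f :=
    let ⟨g, hg⟩ := compHausToTop.map_surjective f.hom
    ⟨g, ObjectProperty.hom_ext _ hg⟩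

/-- For discrete `X`, the map `s⁻¹ : RO(βX) → ℘(X)` is an isomorphism. -/
theorem isIso_preim_s (X : CReg.{u}) [DiscreteTopology X.obj] : IsIso (preim X.s) := by
  -- Every subset is open, so the identity of the powerset factors through `s⁻¹`; a monomorphism
  -- with a section is invertible.
  obtain ⟨δ, hδ⟩ := X.exists_comp_preim_s_eq (𝟙 (powerset X.obj)) fun _ => isOpen_discrete _
  have : Mono (preim X.s) := X.isDeVriesExtension_preim_s.mono
  refine ⟨δ, ?_, hδ⟩
  rw [← cancel_mono (preim X.s), Category.assoc, hδ, Category.comp_id, Category.id_comp]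

end CReg

namespace DeVe

/-- A de Vries extension `α : A → B`, as a morphism `(α, id)` to the identity of `(B, ≤)`. -/
def toIdExtension (E : MDeVe.{u}) : E ⟶ E.obj.top.idExtension :=
  ObjectProperty.homMk
    { ρ := E.obj.map
      σ := 𝟙 E.obj.top
      comm := fun a => congrArg (fun φ => DeV.fn φ a) (Category.comp_id E.obj.map).symm }

/-- On first components the square is the compatibility condition `σ ∘ α = α' ⋆ ρ` of `f` itself. -/
theorem toIdExtension_naturality {E E' : MDeVe.{u}} (f : E ⟶ E') :
    f ≫ toIdExtension E' = toIdExtension E ≫ CABA.toMDeVe.map (DeVe.Hom.σ f.hom) := by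
  refine ObjectProperty.hom_ext _ (DeVe.Hom.ext (DeV.hom_ext fun a => ?_)
    ((Category.comp_id _).trans (Category.id_comp _).symm))
  exact (DeVe.Hom.comm f.hom a).symm.trans
    (CABA.comp_toDeVHom_apply E.obj.map (DeVe.Hom.σ f.hom) a).symm

theorem isIso_toIdExtension (E : MDeVe.{u}) (h : IsIso E.obj.map) : IsIso (toIdExtension E) := by
  obtain ⟨δ, h₁, h₂⟩ := h
  let g : E.obj.top.idExtension ⟶ E := ObjectProperty.homMk
    { ρ := δ
      σ := 𝟙 E.obj.top
      comm := fun a => congrArg (fun φ => DeV.fn φ a) h₂.symm }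
  exact ⟨g, ObjectProperty.hom_ext _ (DeVe.Hom.ext h₁ (Category.id_comp _)),
    ObjectProperty.hom_ext _ (DeVe.Hom.ext h₂ (Category.id_comp _))⟩

end DeVe

namespace CReg

/-- On discrete spaces, the duality restricts to Tarski duality. -/
noncomputable def ofSetToMDeVeIso :
    ofSet.{u}.op ⋙ toMDeVe ≅ tarskiDual ⋙ CABA.toMDeVe :=
  NatIso.ofComponents
    (fun S =>
      have : DiscreteTopology (ofSet.obj S.unop).obj := ⟨rfl⟩
      have := DeVe.isIso_toIdExtension (ofSet.obj S.unop).extension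
        (ofSet.obj S.unop).isIso_preim_s
      @asIso _ _ _ _ (DeVe.toIdExtension (ofSet.obj S.unop).extension) this)
    fun f => DeVe.toIdExtension_naturality (toMDeVe.map (ofSet.map f.unop).op)

/-- The embedding of de Vries algebras into maximal de Vries extensions: the spatial dual, regarded
as a completely regular space. -/
noncomputable def ofDeV : DeV.{u} ⥤ MDeVe.{u} :=
  deVriesDual.asEquivalence.inverse ⋙ ofCompHaus.op ⋙ toMDeVe

/-- The domain of the maximal extension given by a de Vries algebra is that algebra. -/
noncomputable def ofDeVBaseIso : ofDeV.{u} ⋙ MDeVe.baseFunctor ≅ 𝟭 DeV.{u} :=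
  Functor.isoWhiskerLeft deVriesDual.asEquivalence.inverse
    (Functor.isoWhiskerRight (NatIso.op ofCompHausBeta.symm) deVriesDual) ≪≫
    deVriesDual.asEquivalence.counitIso

/-- On compact Hausdorff spaces, the duality restricts to de Vries duality. -/
noncomputable def ofCompHausToMDeVeIso :
    ofCompHaus.{u}.op ⋙ toMDeVe ≅ deVriesDual ⋙ ofDeV :=
  Functor.isoWhiskerRight deVriesDual.asEquivalence.unitIso (ofCompHaus.op ⋙ toMDeVe)

end CReg

theorem theorem6p7 :
    ∃ F : CReg.{u}ᵒᵖ ⥤ MDeVe.{u},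
      -- `F` is a dual equivalence,
      F.IsEquivalence ∧
      -- which sends `X` to `s⁻¹ : RO(βX) → ℘(X)` and `f` to `((βf)^*, f⁻¹)`;
      (∃ (i : F ⋙ MDeVe.baseFunctor ≅ CReg.beta.op ⋙ deVriesDual)
        (j : F ⋙ MDeVe.topFunctor ≅ CReg.points.op ⋙ tarskiDual),
        ∀ (X : CReg.{u}) (a : (F.obj (op X)).obj.base),
          CABA.fn (j.hom.app (op X)) ((F.obj (op X)).obj.fn a) =
            X.pullbackS (DeV.fn (i.hom.app (op X)) a)) ∧
      -- it extends de Vries duality between compact Hausdorff spaces and de Vries algebras,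
      (deVriesDual.{u}.IsEquivalence ∧
        ∃ J : DeV.{u} ⥤ MDeVe.{u}, J.Full ∧ J.Faithful ∧
          Nonempty (J ⋙ MDeVe.baseFunctor ≅ 𝟭 DeV.{u}) ∧
          Nonempty (CReg.ofCompHaus.op ⋙ F ≅ deVriesDual ⋙ J)) ∧
      -- and Tarski duality between sets and complete atomic Boolean algebras.
      (tarskiDual.{u}.IsEquivalence ∧
        CABA.toMDeVe.{u}.Full ∧ CABA.toMDeVe.{u}.Faithful ∧
        Nonempty (CReg.ofSet.op ⋙ F ≅ tarskiDual ⋙ CABA.toMDeVe)) := by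
  have : CReg.ofDeV.{u}.Full := by unfold CReg.ofDeV; infer_instance
  have : CReg.ofDeV.{u}.Faithful := by unfold CReg.ofDeV; infer_instance
  exact ⟨CReg.toMDeVe, inferInstance, ⟨Iso.refl _, Iso.refl _, fun _ _ => rfl⟩,
    ⟨inferInstance, CReg.ofDeV, inferInstance, inferInstance, ⟨CReg.ofDeVBaseIso⟩,
      ⟨CReg.ofCompHausToMDeVeIso⟩⟩,
    inferInstance, inferInstance, inferInstance, ⟨CReg.ofSetToMDeVeIso⟩⟩
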